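/- For $n\in\mathbb{N}$ let $G_n$ be the undirected graph with vertex set $\{0,1,\dots,n\}\times\{0,1\}$ whose edges are, for $0\le i<n$, those joining $(i,0)$ to $(i+1,1)$ (class $\mathcal{V}$), $(i,1)$ to $(i+1,0)$ (class $\mathcal{W}$), $(i,0)$ to $(i+1,0)$ (class $\mathcal{X}$) and $(i,1)$ to $(i+1,1)$ (class $\mathcal{Y}$), so that $G_n$ is a subgraph of $G_{n+1}$. Let the edges $e$ of $\bigcup_n G_n$ carry independent random weights $w(e)$, each exponentially distributed with parameter $1$. The weight of a path is the sum of the weights of the edges that it uses, and $l_n$ denotes the first-passage time from $(0,0)$ to $(n,0)$ in $G_n$, that is, the infimum of the weights of all (undirected) paths in $G_n$ joining $(0,0)$ to $(n,0)$. Then, almost surely, the limit $\lim_{n\to\infty} l_n/n$ (the time constant) exists and $$\lim_{n\to\infty}\frac{l_n}{n}=\frac34-\frac{J_0(\sqrt2)}{2\sqrt2\,J_1(\sqrt2)},$$ where $J_k(x)=\sum_{m\ge 0}\frac{(-1)^m}{m!\,(m+k)!}\left(\frac{x}{2}\right)^{2m+k}$ is the Bessel function of the first kind of order $k$. -/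

import Mathlib

open MeasureTheory ProbabilityTheory Filter Topology

/-- The Bessel function of the first kind of order `k`,
`J_k(x) = ∑_{m ≥ 0} (-1)^m / (m! (m+k)!) (x/2)^(2m+k)`. -/
noncomputable def besselJ (k : ℕ) (x : ℝ) : ℝ :=
  ∑' m : ℕ, (-1 : ℝ) ^ m / ((m.factorial : ℝ) * ((m + k).factorial : ℝ)) * (x / 2) ^ (2 * m + k)

namespace FPP

/-- The weight of a path in a weighted graph: the sum of the weights over the *set* of edges
that the path uses. -/
noncomputable def pathWeight {α : Type*} {G : SimpleGraph α} (w : Sym2 α → ℝ) {u v : α}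
    (p : G.Walk u v) : ℝ :=
  open scoped Classical in ∑ e ∈ p.edges.toFinset, w e

/-- The first-passage time `d_G(u, v)`: the infimum of the weights of all paths from `u` to `v`.
Paths are undirected and may be traversed in any direction along an edge. -/
noncomputable def firstPassageTime {α : Type*} (G : SimpleGraph α) (w : Sym2 α → ℝ)
    (u v : α) : ℝ :=
  ⨅ p : G.Walk u v, pathWeight w p

/-- Vertices of the width-two stretches: `(i, a)` with column `i` and level `a ∈ {0, 1}`. -/
abbrev Vertex : Type := ℕ × Fin 2

/-- The five translation-invariant classes of edges. -/
inductive EdgeClass : Type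
  | V | W | X | Y | Z

/-- The (unoriented) edges of a given class on the columns `0, …, n`, each listed once
as an ordered pair of end points. -/
def EdgeClass.pairs : EdgeClass → ℕ → Set (Vertex × Vertex)
  | .V, n => {p | ∃ i : ℕ, i < n ∧ p = ((i, 0), (i + 1, 1))}
  | .W, n => {p | ∃ i : ℕ, i < n ∧ p = ((i, 1), (i + 1, 0))}
  | .X, n => {p | ∃ i : ℕ, i < n ∧ p = ((i, 0), (i + 1, 0))}
  | .Y, n => {p | ∃ i : ℕ, i < n ∧ p = ((i, 1), (i + 1, 1))}
  | .Z, n => {p | ∃ i : ℕ, i ≤ n ∧ p = ((i, 0), (i, 1))}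

/-- The graph with vertex set `{0, …, n} × {0, 1}` whose edges are those of the classes in `E`.
It is realised on the ambient vertex type `ℕ × {0, 1}`; the vertices in columns larger than `n`
are isolated, so that a path starting in `{0, …, n} × {0, 1}` never leaves this set. -/
def stretch (E : Set EdgeClass) (n : ℕ) : SimpleGraph Vertex :=
  SimpleGraph.fromRel fun u v => ∃ c ∈ E, (u, v) ∈ c.pairs n

/-- The union over all `n` of the increasing family of graphs `stretch E n`. -/
def fullStretch (E : Set EdgeClass) : SimpleGraph Vertex :=
  ⨆ n : ℕ, stretch E n

/-- `l_n`: the first-passage time from `(0, 0)` to `(n, 0)` in `stretch E n`. -/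
noncomputable def passageTime (E : Set EdgeClass) (w : Sym2 Vertex → ℝ) (n : ℕ) : ℝ :=
  firstPassageTime (stretch E n) w (0, 0) (n, 0)

end FPP

/-!
Between two consecutive columns the graph is complete bipartite, so the pair `(l, l')` of passage
times to the two vertices of a column is a Markov chain driven by the four weights of the next
layer (`passageTime_eq_arrival`). Its smaller entry `m = min l l'` has nonnegative increments, and
these, like the next gap, depend on the past in law only through `z = |l' - l|`
(`integral_layerStep`).

With exponential weights the step can be computed. The smaller entry grows by
`min (min x v) (z + min w y)`, with mean `1/2 - q/4` for `q = exp (-2 z)`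
(`integral_min_layerStep`). The modulus of the new gap exceeds `t` with the probability given in
`measureReal_lt_abs_stepGap`; its Laplace transform (`integral_exp_neg_abs_stepGap`) shows that the
kernel maps `q ^ k` to an affine function of `q` minus `q ^ (k + 1) / (2 (k + 1) ^ 2)`. The factor
`-1 / (2 (k + 1) ^ 2)` is the quotient of consecutive coefficients of
`J₀(√2 √q) = ∑ (-1) ^ k q ^ k / (k! ^ 2 * 2 ^ k)`, so the kernel maps this function to itself up to
an affine function of `q` (`integral_corrector_stepGap`). A multiple `h` of it therefore solves the
Poisson equation: the mean growth of `m` plus the mean change of `h` is a constant, the time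
constant (`integral_increment`).

Hence `m_n - c n + h` is a martingale with orthogonal increments of bounded variance. Its second
moment grows at most linearly, so it is `o(n)` almost surely along the squares, and since `h` is
bounded and `m_n` is monotone, `m_n / n` converges to `c` almost surely. Finally `l_n - m_n` is at
most the sum of two weights, which is `o(n)`. No invariant law or ergodic theorem is needed.
-/

/-! ### First-passage times as a recursion over the layers -/

namespace FPP

lemma pathWeight_nonneg {α : Type*} {G : SimpleGraph α} {w : Sym2 α → ℝ}
    (hw : ∀ e ∈ G.edgeSet, 0 ≤ w e) {u v : α} (p : G.Walk u v) : 0 ≤ pathWeight w p := by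
  classical
  unfold pathWeight
  exact Finset.sum_nonneg fun e he => hw e (p.edges_subset_edgeSet (List.mem_toFinset.1 he))

lemma pathWeight_concat_le {α : Type*} {G : SimpleGraph α} {w : Sym2 α → ℝ}
    (hw : ∀ e ∈ G.edgeSet, 0 ≤ w e) {u v v' : α} (p : G.Walk u v) (h : G.Adj v v') :
    pathWeight w (p.concat h) ≤ pathWeight w p + w s(v, v') := by
  classical
  unfold pathWeight
  have : (p.concat h).edges.toFinset = p.edges.toFinset ∪ {s(v, v')} := by
    ext e; simp [SimpleGraph.Walk.edges_concat]
  rw [this]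
  have hs := Finset.sum_union_inter (s₁ := p.edges.toFinset) (s₂ := {s(v, v')}) (f := w)
  have hi : 0 ≤ ∑ e ∈ p.edges.toFinset ∩ {s(v, v')}, w e :=
    Finset.sum_nonneg fun e he =>
      hw e (p.edges_subset_edgeSet (List.mem_toFinset.1 (Finset.mem_inter.1 he).1))
  rw [Finset.sum_singleton] at hs
  linarith

lemma pathWeight_mapLe {α : Type*} {G G' : SimpleGraph α} (hG : G ≤ G') (w : Sym2 α → ℝ)
    {u v : α} (p : G.Walk u v) : pathWeight w (p.mapLe hG) = pathWeight w p := by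
  unfold pathWeight
  rw [SimpleGraph.Walk.edges_mapLe_eq_edges]

/-- Weak duality: a function that is `1`-Lipschitz along the edges grows by at most the weight
of a walk. Passing to a path contained in the walk makes the edge list duplicate-free. -/
lemma potential_le_add_pathWeight {α : Type*} {G : SimpleGraph α} {w : Sym2 α → ℝ}
    {D : α → ℝ} (hD : ∀ u v, G.Adj u v → D v ≤ D u + w s(u, v))
    (hw : ∀ e ∈ G.edgeSet, 0 ≤ w e) {u v : α} (p : G.Walk u v) :
    D v ≤ D u + pathWeight w p := by
  classical
  have hlist : ∀ {u v : α} (q : G.Walk u v), D v ≤ D u + (q.edges.map w).sum := by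
    intro u v q
    induction q with
    | nil => simp
    | cons h q ih =>
      have := hD _ _ h
      simp only [SimpleGraph.Walk.edges_cons, List.map_cons, List.sum_cons]
      linarith
  have h1 := hlist p.bypass
  have h2 : (p.bypass.edges.map w).sum = ∑ e ∈ p.bypass.edges.toFinset, w e :=
    (List.sum_toFinset w p.bypass_isPath.isTrail.edges_nodup).symm
  have h3 : ∑ e ∈ p.bypass.edges.toFinset, w e ≤ pathWeight w p := by
    unfold pathWeight
    have hsub : p.bypass.edges.toFinset ⊆ p.edges.toFinset := by
      intro e he
      exact List.mem_toFinset.2 (p.edges_bypass_subset_edges (List.mem_toFinset.1 he))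
    convert Finset.sum_le_sum_of_subset_of_nonneg hsub
      (fun e he _ => hw e (p.edges_subset_edgeSet (List.mem_toFinset.1 he)))
  linarith

/-- Weights on one layer, as `((x, w), (v, y))`: the first pair holds the weights of the
edges that enter level `0` of the next column (from level `0`, then from level `1`), the second
pair those of the edges that enter level `1`. -/
abbrev Layer : Type := (ℝ × ℝ) × (ℝ × ℝ)

/-- The weights of the edges between the columns `n` and `n + 1`. -/
noncomputable def layerWeights (w : Sym2 Vertex → ℝ) (n : ℕ) : Layer :=
  ((w s((n, 0), (n + 1, 0)), w s((n, 1), (n + 1, 0))),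
    (w s((n, 0), (n + 1, 1)), w s((n, 1), (n + 1, 1))))

/-- The cost of changing level in a column by stepping into the next column and back. -/
noncomputable def detour (e : Layer) : ℝ := min (e.1.1 + e.1.2) (e.2.1 + e.2.2)

/-- From the first-passage times to the two vertices of a column to those of the next column. -/
noncomputable def layerStep (s : ℝ × ℝ) (e : Layer) : ℝ × ℝ :=
  (min (min s.1 (s.2 + detour e) + e.1.1) (min s.2 (s.1 + detour e) + e.1.2),
    min (min s.1 (s.2 + detour e) + e.2.1) (min s.2 (s.1 + detour e) + e.2.2))

/-- The first-passage times from `(0, 0)` to the two vertices of column `n` in the graph on the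
columns `0, …, n`. In column `0` the level `1` is out of reach without the next column;
taking the detour over column `1` as initial value gives the right times from column `1` on. -/
noncomputable def arrival (ξ : ℕ → Layer) : ℕ → ℝ × ℝ
  | 0 => (0, detour (ξ 0))
  | n + 1 => layerStep (arrival ξ n) (ξ n)

lemma stretch_adj_iff {n : ℕ} {u v : Vertex} : (stretch {.V, .W, .X, .Y} n).Adj u v ↔
    ∃ i < n, ∃ a b : Fin 2, (u = (i, a) ∧ v = (i + 1, b)) ∨ (v = (i, a) ∧ u = (i + 1, b)) := by
  have key : ∀ u v : Vertex, (∃ c ∈ ({.V, .W, .X, .Y} : Set EdgeClass), (u, v) ∈ c.pairs n) ↔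
      ∃ i < n, ∃ a b : Fin 2, u = (i, a) ∧ v = (i + 1, b) := by
    intro u v
    simp only [Set.mem_insert_iff, Set.mem_singleton_iff, exists_eq_or_imp, exists_eq_left,
      EdgeClass.pairs, Set.mem_ofPred_eq, Fin.exists_fin_two, Prod.mk.injEq]
    constructor
    · rintro (⟨i, h, h1, h2⟩ | ⟨i, h, h1, h2⟩ | ⟨i, h, h1, h2⟩ | ⟨i, h, h1, h2⟩) <;>
        exact ⟨i, h, by tauto⟩
    · rintro ⟨i, h, (h1 | h1) | (h1 | h1)⟩
      · exact Or.inr (Or.inr (Or.inl ⟨i, h, h1⟩))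
      · exact Or.inl ⟨i, h, h1⟩
      · exact Or.inr (Or.inl ⟨i, h, h1⟩)
      · exact Or.inr (Or.inr (Or.inr ⟨i, h, h1⟩))
  unfold stretch
  rw [SimpleGraph.fromRel_adj, key, key]
  constructor
  · rintro ⟨-, ⟨i, h, a, b, h1⟩ | ⟨i, h, a, b, h1⟩⟩
    · exact ⟨i, h, a, b, Or.inl h1⟩
    · exact ⟨i, h, a, b, Or.inr h1⟩
  · rintro ⟨i, h, a, b, ⟨rfl, rfl⟩ | ⟨rfl, rfl⟩⟩
    · exact ⟨by simp, Or.inl ⟨i, h, a, b, rfl, rfl⟩⟩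
    · exact ⟨by simp, Or.inr ⟨i, h, a, b, rfl, rfl⟩⟩

lemma stretch_adj {n i : ℕ} (h : i < n) (a b : Fin 2) :
    (stretch {.V, .W, .X, .Y} n).Adj (i, a) (i + 1, b) :=
  stretch_adj_iff.2 ⟨i, h, a, b, Or.inl ⟨rfl, rfl⟩⟩

lemma stretch_mono : Monotone (stretch {.V, .W, .X, .Y}) := by
  intro m n hmn u v h
  obtain ⟨i, hi, h⟩ := stretch_adj_iff.1 h
  exact stretch_adj_iff.2 ⟨i, hi.trans_le hmn, h⟩

section Deterministic

variable {w : Sym2 Vertex → ℝ} (hw : ∀ (i : ℕ) (a b : Fin 2), 0 ≤ w s((i, a), (i + 1, b)))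
include hw

lemma weight_nonneg_of_mem_stretch {n : ℕ} :
    ∀ e ∈ (stretch {.V, .W, .X, .Y} n).edgeSet, 0 ≤ w e := by
  intro e
  induction e with
  | h u v =>
    intro h
    obtain ⟨i, -, a, b, ⟨rfl, rfl⟩ | ⟨rfl, rfl⟩⟩ :=
      stretch_adj_iff.1 ((SimpleGraph.mem_edgeSet _).1 h)
    · exact hw i a b
    · rw [Sym2.eq_swap]; exact hw i a b

lemma detour_nonneg (n : ℕ) : 0 ≤ detour (layerWeights w n) :=
  le_min (add_nonneg (hw _ _ _) (hw _ _ _)) (add_nonneg (hw _ _ _) (hw _ _ _))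

lemma arrival_nonneg (n : ℕ) :
    0 ≤ (arrival (layerWeights w) n).1 ∧ 0 ≤ (arrival (layerWeights w) n).2 := by
  induction n with
  | zero => exact ⟨le_rfl, detour_nonneg hw 0⟩
  | succ n ih =>
    have hc := detour_nonneg hw n
    have h1 : 0 ≤ min (arrival (layerWeights w) n).1
        ((arrival (layerWeights w) n).2 + detour (layerWeights w n)) :=
      le_min ih.1 (by linarith)
    have h2 : 0 ≤ min (arrival (layerWeights w) n).2
        ((arrival (layerWeights w) n).1 + detour (layerWeights w n)) :=
      le_min ih.2 (by linarith)
    exact ⟨le_min (add_nonneg h1 (hw n 0 0)) (add_nonneg h2 (hw n 1 0)),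
      le_min (add_nonneg h1 (hw n 0 1)) (add_nonneg h2 (hw n 1 1))⟩

/-- The recursion is a lower bound: a `1`-Lipschitz potential with the prescribed values on the
last column. It is extended to a further column by truncating it at the least value on the last
column plus the cost of the detour. -/
lemma exists_potential (n : ℕ) : ∃ D : Vertex → ℝ, D (0, 0) = 0 ∧
    D (n, 0) = (arrival (layerWeights w) n).1 ∧ D (n, 1) = (arrival (layerWeights w) n).2 ∧
    ∀ i < n, ∀ a b : Fin 2,
      D (i, a) ≤ D (i + 1, b) + w s((i, a), (i + 1, b)) ∧
      D (i + 1, b) ≤ D (i, a) + w s((i, a), (i + 1, b)) := by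
  induction n with
  | zero =>
    exact ⟨fun v => if v.2 = 0 then 0 else detour (layerWeights w 0), by simp, by simp [arrival],
      by simp [arrival], by simp⟩
  | succ n ih =>
    obtain ⟨D, h0, hl, hl', hD⟩ := ih
    obtain ⟨hp, hp'⟩ := arrival_nonneg hw n
    have hc := detour_nonneg hw n
    set l := (arrival (layerWeights w) n).1
    set l' := (arrival (layerWeights w) n).2
    set c := detour (layerWeights w n)
    set E : Vertex → ℝ := fun v => if v.1 ≤ n then min (D v) (min l l' + c) else
      if v.2 = 0 then (arrival (layerWeights w) (n + 1)).1
      else (arrival (layerWeights w) (n + 1)).2 with hE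
    have e1 : ∀ i ≤ n, ∀ a, E (i, a) = min (D (i, a)) (min l l' + c) := by
      intro i hi a; simp [hE, hi]
    have e2 : E (n + 1, 0) = (arrival (layerWeights w) (n + 1)).1 := by simp [hE]
    have e3 : E (n + 1, 1) = (arrival (layerWeights w) (n + 1)).2 := by simp [hE]
    have e4 : E (n, 0) = min l (l' + c) := by rw [e1 n le_rfl, hl]; grind
    have e5 : E (n, 1) = min l' (l + c) := by rw [e1 n le_rfl, hl']; grind
    refine ⟨E, ?_, e2, e3, ?_⟩
    · rw [e1 0 (Nat.zero_le n), h0]; exact min_eq_left (add_nonneg (le_min hp hp') hc)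
    · intro i hi a b
      rcases Nat.lt_succ_iff_lt_or_eq.1 hi with hi | rfl
      · rw [e1 i hi.le, e1 (i + 1) hi]
        obtain ⟨hD1, hD2⟩ := hD i hi a b
        have := hw i a b
        have htr : ∀ {p q k t : ℝ}, 0 ≤ t → p ≤ q + t → min p k ≤ min q k + t := by
          intro p q k t ht h
          rw [← min_add_add_right q k]
          exact min_le_min h (by linarith)
        exact ⟨htr this hD1, htr this hD2⟩
      · have h00 := hw i 0 0
        have h01 := hw i 0 1
        have h10 := hw i 1 0
        have h11 := hw i 1 1
        have f1 : E (i + 1, 0) = min (E (i, 0) + w s((i, 0), (i + 1, 0)))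
            (E (i, 1) + w s((i, 1), (i + 1, 0))) := by rw [e2, e4, e5]; rfl
        have f2 : E (i + 1, 1) = min (E (i, 0) + w s((i, 0), (i + 1, 1)))
            (E (i, 1) + w s((i, 1), (i + 1, 1))) := by rw [e3, e4, e5]; rfl
        have c1 : c ≤ w s((i, 0), (i + 1, 0)) + w s((i, 1), (i + 1, 0)) := min_le_left _ _
        have c2 : c ≤ w s((i, 0), (i + 1, 1)) + w s((i, 1), (i + 1, 1)) := min_le_right _ _
        have g1 : E (i, 0) ≤ E (i, 1) + c := by rw [e4, e5]; grind
        have g2 : E (i, 1) ≤ E (i, 0) + c := by rw [e4, e5]; grind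
        have hmin : ∀ {p q r t d : ℝ}, 0 ≤ t → p ≤ q + d → d ≤ t + r →
            p ≤ min (p + t) (q + r) + t := by
          intro p q r t d ht h1 h2
          rw [← min_add_add_right]
          exact le_min (by linarith) (by linarith)
        fin_cases a <;> fin_cases b <;> simp only [Fin.zero_eta, Fin.mk_one, f1, f2]
        · exact ⟨hmin h00 g1 c1, min_le_left _ _⟩
        · exact ⟨hmin h01 g1 c2, min_le_left _ _⟩
        · exact ⟨by rw [min_comm]; exact hmin h10 g2 (by linarith), min_le_right _ _⟩
        · exact ⟨by rw [min_comm]; exact hmin h11 g2 (by linarith), min_le_right _ _⟩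

/-- The recursion is an upper bound: walks that follow its minimisers. -/
lemma exists_walk_le (n : ℕ) :
    (∃ p : (stretch {.V, .W, .X, .Y} n).Walk (0, 0) (n, 0),
      pathWeight w p ≤ (arrival (layerWeights w) n).1) ∧
    ∃ p : (stretch {.V, .W, .X, .Y} (n + 1)).Walk (0, 0) (n, 1),
      pathWeight w p ≤ min (arrival (layerWeights w) n).2
        ((arrival (layerWeights w) n).1 + detour (layerWeights w n)) := by
  have hS := fun n => weight_nonneg_of_mem_stretch hw (n := n)
  -- Changing level in the last column by a detour over the next one.
  have hdet : ∀ (n : ℕ) (a b : Fin 2) (p : (stretch {.V, .W, .X, .Y} (n + 1)).Walk (0, 0) (n, a)),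
      a ≠ b → ∃ q : (stretch {.V, .W, .X, .Y} (n + 1)).Walk (0, 0) (n, b),
        pathWeight w q ≤ pathWeight w p + detour (layerWeights w n) := by
    intro n a b p hab
    have hk : ∀ k : Fin 2, ∃ q : (stretch {.V, .W, .X, .Y} (n + 1)).Walk (0, 0) (n, b),
        pathWeight w q ≤ pathWeight w p + (w s((n, a), (n + 1, k)) + w s((n, b), (n + 1, k))) := by
      intro k
      have a1 := stretch_adj (Nat.lt_succ_self n) a k
      have a2 := (stretch_adj (Nat.lt_succ_self n) b k).symm
      refine ⟨(p.concat a1).concat a2, ?_⟩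
      have b1 := pathWeight_concat_le (hS _) p a1
      have b2 := pathWeight_concat_le (hS _) (p.concat a1) a2
      rw [Sym2.eq_swap (a := (n + 1, k))] at b2
      linarith
    have hd : detour (layerWeights w n) = min (w s((n, a), (n + 1, 0)) + w s((n, b), (n + 1, 0)))
        (w s((n, a), (n + 1, 1)) + w s((n, b), (n + 1, 1))) := by
      fin_cases a <;> fin_cases b <;> simp_all [detour, layerWeights, add_comm]
    rcases min_choice (w s((n, a), (n + 1, 0)) + w s((n, b), (n + 1, 0)))
        (w s((n, a), (n + 1, 1)) + w s((n, b), (n + 1, 1))) with h | h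
    · rw [hd, h]; exact hk 0
    · rw [hd, h]; exact hk 1
  induction n with
  | zero =>
    refine ⟨⟨SimpleGraph.Walk.nil, by simp [pathWeight, arrival]⟩, ?_⟩
    obtain ⟨q, hq⟩ := hdet 0 0 1 SimpleGraph.Walk.nil (by decide)
    exact ⟨q, by simpa [pathWeight, arrival] using hq⟩
  | succ n ih =>
    obtain ⟨⟨p0, hp0⟩, p1, hp1⟩ := ih
    set s := arrival (layerWeights w) n
    set c := detour (layerWeights w n)
    have hc : 0 ≤ c := detour_nonneg hw n
    have hle := stretch_mono (Nat.le_succ n)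
    obtain ⟨q0, hq0⟩ : ∃ q : (stretch {.V, .W, .X, .Y} (n + 1)).Walk (0, 0) (n, 0),
        pathWeight w q ≤ min s.1 (s.2 + c) := by
      obtain ⟨r, hr⟩ := hdet n 1 0 p1 (by decide)
      have hm := pathWeight_mapLe hle w p0
      by_cases h : s.1 ≤ s.2 + c
      · exact ⟨p0.mapLe hle, by rw [hm, min_eq_left h]; exact hp0⟩
      · refine ⟨r, ?_⟩
        rw [min_eq_right (not_le.1 h).le]
        exact hr.trans (by gcongr; exact hp1.trans (min_le_left _ _))
    have hnew : ∀ b : Fin 2, ∃ q : (stretch {.V, .W, .X, .Y} (n + 1)).Walk (0, 0) (n + 1, b),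
        pathWeight w q ≤ min (min s.1 (s.2 + c) + w s((n, 0), (n + 1, b)))
          (min s.2 (s.1 + c) + w s((n, 1), (n + 1, b))) := by
      intro b
      have a0 := stretch_adj (Nat.lt_succ_self n) 0 b
      have a1 := stretch_adj (Nat.lt_succ_self n) 1 b
      have b0 := pathWeight_concat_le (hS _) q0 a0
      have b1 := pathWeight_concat_le (hS _) p1 a1
      rcases min_choice (min s.1 (s.2 + c) + w s((n, 0), (n + 1, b)))
          (min s.2 (s.1 + c) + w s((n, 1), (n + 1, b))) with h | h
      · exact ⟨_, by rw [h]; exact b0.trans (by gcongr)⟩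
      · exact ⟨_, by rw [h]; exact b1.trans (by gcongr)⟩
    obtain ⟨r0, hr0⟩ := hnew 0
    obtain ⟨r1, hr1⟩ := hnew 1
    refine ⟨⟨r0, hr0⟩, ?_⟩
    have hle' := stretch_mono (Nat.le_succ (n + 1))
    obtain ⟨t, ht⟩ := hdet (n + 1) 0 1 (r0.mapLe hle') (by decide)
    rw [pathWeight_mapLe] at ht
    have hm := pathWeight_mapLe hle' w r1
    rcases min_choice (arrival (layerWeights w) (n + 1)).2
        ((arrival (layerWeights w) (n + 1)).1 + detour (layerWeights w (n + 1))) with h | h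
    · exact ⟨r1.mapLe hle', by rw [hm, h]; exact hr1⟩
    · exact ⟨t, by rw [h]; exact ht.trans (by gcongr; exact hr0)⟩

theorem passageTime_eq_arrival (n : ℕ) :
    passageTime {.V, .W, .X, .Y} w n = (arrival (layerWeights w) n).1 := by
  have hS := weight_nonneg_of_mem_stretch hw (n := n)
  obtain ⟨p, hp⟩ := (exists_walk_le hw n).1
  have : Nonempty ((stretch {.V, .W, .X, .Y} n).Walk (0, 0) (n, 0)) := ⟨p⟩
  unfold passageTime firstPassageTime
  apply le_antisymm
  · refine (ciInf_le ⟨0, ?_⟩ p).trans hp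
    rintro _ ⟨q, rfl⟩
    exact pathWeight_nonneg hS q
  · obtain ⟨D, h0, h1, -, hD⟩ := exists_potential hw n
    refine le_ciInf fun q => ?_
    have hq := potential_le_add_pathWeight (D := D) ?_ hS q
    · rw [h0, h1] at hq; linarith
    · intro u v huv
      obtain ⟨i, hi, a, b, ⟨rfl, rfl⟩ | ⟨rfl, rfl⟩⟩ := stretch_adj_iff.1 huv
      · exact (hD i hi a b).2
      · rw [Sym2.eq_swap]; exact (hD i hi a b).1

end Deterministic

end FPP

/-! ### Integrals against the exponential law -/

namespace FPP

open Set Real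

instance : IsProbabilityMeasure (expMeasure 1) := isProbabilityMeasure_expMeasure one_pos

lemma expMeasure_one_eq : expMeasure 1 =
    (volume.restrict (Ioi (0 : ℝ))).withDensity fun x => ENNReal.ofReal (exp (-x)) := by
  have h : gammaPDF 1 1 = (Ici (0 : ℝ)).indicator fun x => ENNReal.ofReal (exp (-x)) := by
    ext x
    by_cases hx : 0 ≤ x
    · rw [indicator_of_mem (mem_Ici.2 hx), gammaPDF_of_nonneg hx]; simp
    · rw [indicator_of_notMem (by simpa using hx), gammaPDF_of_neg (not_le.1 hx)]
  rw [expMeasure, gammaMeasure, h, withDensity_indicator measurableSet_Ici,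
    restrict_Ioi_eq_restrict_Ici]

lemma integrable_expMeasure_iff {f : ℝ → ℝ} :
    Integrable f (expMeasure 1) ↔ IntegrableOn (fun x => exp (-x) * f x) (Ioi 0) := by
  rw [expMeasure_one_eq, integrable_withDensity_iff_integrable_smul' (by fun_prop) (by simp)]
  simp [IntegrableOn, ENNReal.toReal_ofReal (exp_pos _).le]

lemma integral_expMeasure (f : ℝ → ℝ) :
    ∫ x, f x ∂(expMeasure 1) = ∫ x in Ioi 0, exp (-x) * f x := by
  rw [expMeasure_one_eq, integral_withDensity_eq_integral_toReal_smul (by fun_prop) (by simp)]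
  simp [ENNReal.toReal_ofReal (exp_pos _).le]

lemma ae_nonneg_expMeasure : ∀ᵐ x ∂(expMeasure 1), 0 ≤ x := by
  rw [expMeasure_one_eq]
  refine (withDensity_absolutelyContinuous _ _).ae_le ?_
  exact (ae_restrict_mem measurableSet_Ioi).mono fun x hx => le_of_lt hx

lemma integrable_sq_expMeasure : Integrable (fun x => x ^ 2) (expMeasure 1) := by
  rw [integrable_expMeasure_iff]
  refine (GammaIntegral_convergent (s := 3) (by norm_num)).congr_fun ?_ measurableSet_Ioi
  intro x _
  norm_num

lemma expMeasure_Ioi (t : ℝ) : expMeasure 1 (Ioi t) = ENNReal.ofReal (exp (-max t 0)) := by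
  rw [expMeasure_one_eq, withDensity_apply _ measurableSet_Ioi,
    Measure.restrict_restrict measurableSet_Ioi, Ioi_inter_Ioi,
    ← ofReal_integral_eq_lintegral_ofReal
      (by simpa [IntegrableOn] using exp_neg_integrableOn_Ioi (max t 0) one_pos)
      (ae_of_all _ fun x => (exp_pos _).le), integral_exp_neg_Ioi]

lemma integrableOn_exp_mul_Ioi' {b : ℝ} (hb : 0 < b) (C c : ℝ) :
    IntegrableOn (fun x => C * exp (-(b * x))) (Ioi c) := by
  have := (integrableOn_exp_mul_Ioi (neg_lt_zero.2 hb) c).const_mul C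
  simpa only [neg_mul, IntegrableOn] using this

lemma integral_exp_mul_Ioi' {b : ℝ} (hb : 0 < b) (C c : ℝ) :
    ∫ x in Ioi c, C * exp (-(b * x)) = C * exp (-(b * c)) / b := by
  have := integral_exp_mul_Ioi (neg_lt_zero.2 hb) c
  rw [integral_const_mul]
  simp only [neg_mul] at this
  rw [this]; field_simp

lemma setIntegral_Ioc_of_hasDerivAt {a c : ℝ} (hc : a ≤ c) {f F F' : ℝ → ℝ}
    (hF : ∀ x, HasDerivAt F (F' x) x) (hF' : Continuous F') (h : ∀ x ∈ Ioc a c, f x = F' x) :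
    IntegrableOn f (Ioc a c) ∧ ∫ x in Ioc a c, f x = F c - F a := by
  constructor
  · exact ((hF'.integrableOn_Icc (a := a) (b := c)).mono_set Ioc_subset_Icc_self).congr_fun
      (fun x hx => (h x hx).symm) measurableSet_Ioc
  · rw [setIntegral_congr_fun measurableSet_Ioc h, ← intervalIntegral.integral_of_le hc,
      intervalIntegral.integral_eq_sub_of_hasDerivAt (fun x _ => hF x)
        (hF'.intervalIntegrable _ _)]

/-- Integral over a half-line of a function that is elementary up to a point `c`, with
antiderivative `F`, and a multiple of an exponential beyond it. -/
lemma integral_Ioi_of_split {a c b C : ℝ} (hc : a ≤ c) (hb : 0 < b) {f F F' : ℝ → ℝ}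
    (hF : ∀ x, HasDerivAt F (F' x) x) (hF' : Continuous F')
    (h1 : ∀ x ∈ Ioc a c, f x = F' x) (h2 : ∀ x ∈ Ioi c, f x = C * exp (-(b * x))) :
    IntegrableOn f (Ioi a) ∧
      ∫ x in Ioi a, f x = F c - F a + C * exp (-(b * c)) / b := by
  obtain ⟨i1, e1⟩ := setIntegral_Ioc_of_hasDerivAt hc hF hF' h1
  have i2 : IntegrableOn f (Ioi c) :=
    (integrableOn_exp_mul_Ioi' hb C c).congr_fun (fun x hx => (h2 x hx).symm) measurableSet_Ioi
  have hu : Ioc a c ∪ Ioi c = Ioi a := Ioc_union_Ioi_eq_Ioi hc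
  constructor
  · rw [← hu]; exact i1.union i2
  · rw [← hu, setIntegral_union (Ioc_disjoint_Ioi le_rfl) measurableSet_Ioi i1 i2, e1,
      setIntegral_congr_fun measurableSet_Ioi h2, integral_exp_mul_Ioi' hb]

lemma hasDerivAt_exp_neg_mul (b x : ℝ) :
    HasDerivAt (fun x => exp (-(b * x))) (-(b * exp (-(b * x)))) x := by
  have h : HasDerivAt (fun x => -(b * x)) (-b) x := by
    simpa using ((hasDerivAt_id x).const_mul (-b))
  exact h.exp.congr_deriv (by ring)

lemma integral_exp_min_expMeasure {r : ℝ} (hr : 0 ≤ r) :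
    ∫ w, exp (min r w) ∂(expMeasure 1) = 1 + r := by
  rw [integral_expMeasure, (integral_Ioi_of_split (f := fun w => exp (-w) * exp (min r w))
    (F := fun x => x) (F' := fun _ => 1) (b := 1) (C := exp r) hr one_pos
    (fun x => hasDerivAt_id x) continuous_const ?_ ?_).2]
  · rw [← exp_add]; simp [add_comm]
  · intro x hx; simp [min_eq_right hx.2, ← exp_add]
  · intro x hx; rw [min_eq_left (le_of_lt hx)]; simp [mul_comm]

lemma integral_exp_neg_two_mul_min_expMeasure {r : ℝ} (hr : 0 ≤ r) :
    ∫ w, exp (-(2 * min r w)) ∂(expMeasure 1) = 1 / 3 + 2 / 3 * exp (-(3 * r)) := by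
  rw [integral_expMeasure, (integral_Ioi_of_split (f := fun w => exp (-w) * exp (-(2 * min r w)))
    (F := fun x => -1 / 3 * exp (-(3 * x))) (F' := fun x => exp (-(3 * x))) (b := 1)
    (C := exp (-(2 * r))) hr one_pos ?_ (by fun_prop) ?_ ?_).2]
  · have : exp (-(2 * r)) * exp (-(1 * r)) = exp (-(3 * r)) := by rw [← exp_add]; congr 1; ring
    rw [this, mul_zero, neg_zero, exp_zero]; ring
  · intro x
    exact ((hasDerivAt_exp_neg_mul 3 x).const_mul (-1 / 3)).congr_deriv (by ring)
  · intro x hx; rw [min_eq_right hx.2, ← exp_add]; congr 1; ring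
  · intro x hx; rw [min_eq_left (le_of_lt hx)]; simp [mul_comm]

/-! ### The law of one step of the recursion -/

/-- The joint law of the four independent weights of a layer. -/
noncomputable def layerLaw : Measure Layer :=
  ((expMeasure 1).prod (expMeasure 1)).prod ((expMeasure 1).prod (expMeasure 1))

instance : IsProbabilityMeasure layerLaw := by unfold layerLaw; infer_instance

lemma ae_nonneg_expMeasure_prod :
    ∀ᵐ p ∂((expMeasure 1).prod (expMeasure 1)), 0 ≤ p.1 ∧ 0 ≤ p.2 :=
  (Measure.quasiMeasurePreserving_fst.ae ae_nonneg_expMeasure).and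
    (Measure.quasiMeasurePreserving_snd.ae ae_nonneg_expMeasure)

lemma ae_nonneg_layerLaw :
    ∀ᵐ e ∂layerLaw, (0 ≤ e.1.1 ∧ 0 ≤ e.1.2) ∧ (0 ≤ e.2.1 ∧ 0 ≤ e.2.2) :=
  (Measure.quasiMeasurePreserving_fst.ae ae_nonneg_expMeasure_prod).and
    (Measure.quasiMeasurePreserving_snd.ae ae_nonneg_expMeasure_prod)

@[fun_prop]
lemma measurable_detour : Measurable detour := by
  unfold detour; fun_prop

lemma measurable_layerStep : Measurable fun q : (ℝ × ℝ) × Layer => layerStep q.1 q.2 := by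
  unfold layerStep detour; fun_prop

/-- The difference of the two passage times after a step from the passage times `0` and `z`. -/
noncomputable def stepGap (z : ℝ) (e : Layer) : ℝ := (layerStep (0, z) e).2 - (layerStep (0, z) e).1

lemma measurable_stepGap (z : ℝ) : Measurable (stepGap z) := by
  unfold stepGap layerStep detour; fun_prop

/-- In the event that the gap exceeds `t`, the detours ending with the edge `w` or `y` that also
use `v` can be ignored: they never undercut `v`, which bounds the passage time to level `1`. -/
lemma lt_stepGap_iff {x w v y z t : ℝ} (hx : 0 ≤ x) (hw : 0 ≤ w) (hv : 0 ≤ v) (hy : 0 ≤ y)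
    (hz : 0 ≤ z) (ht : 0 ≤ t) : t < stepGap z ((x, w), (v, y)) ↔
      t + min x (w + z) < v ∧ t + min x (w + z) - min z (x + w) < y := by
  have h0 : min 0 (z + min (x + w) (v + y)) = 0 := min_eq_left (by positivity)
  simp only [stepGap, layerStep, detour, h0, zero_add]
  rw [lt_sub_iff_add_lt, lt_min_iff]
  constructor
  · rintro ⟨h1, h2⟩
    have hA : min x (w + z) = min x (min z (min (x + w) (v + y)) + w) := by
      apply le_antisymm
      · refine le_min (min_le_left _ _) ?_
        rw [← min_add_add_right, ← min_add_add_right]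
        by_contra! hcon
        have h2' : min x (w + z) ≤ x := min_le_left _ _
        have h3 := min_le_right x (w + z)
        rcases min_lt_iff.1 hcon with h | h
        · linarith
        · rcases min_lt_iff.1 h with h | h
          · linarith
          · have : min x (min z (min (x + w) (v + y)) + w) ≤ v + y + w :=
              (min_le_right _ _).trans
                (by gcongr; exact (min_le_right _ _).trans (min_le_right _ _))
            have h5 : v < min x (w + z) := by linarith
            have h6 : v < x := h5.trans_le (min_le_left _ _)
            have h7 : v < w + z := h5.trans_le (min_le_right _ _)
            have h8 : v + y + w < x := h.trans_le (min_le_left _ _)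
            have h9 : v + y < z := by linarith [h.trans_le h3]
            have h10 : min x (min z (min (x + w) (v + y)) + w) < v := by linarith
            rcases min_lt_iff.1 h10 with h | h
            · linarith
            · rw [min_eq_right (by linarith : v + y ≤ x + w), min_eq_right h9.le] at h
              linarith
      · refine min_le_min_left _ ?_
        linarith [min_le_left z (min (x + w) (v + y))]
    rw [← hA] at h1 h2
    refine ⟨h1, ?_⟩
    have : min z (min (x + w) (v + y)) ≤ min z (x + w) := min_le_min_left _ (min_le_left _ _)
    linarith
  · rintro ⟨h1, h2⟩
    have hA : min x (min z (min (x + w) (v + y)) + w) ≤ min x (w + z) :=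
      min_le_min_left _ (by linarith [min_le_left z (min (x + w) (v + y))])
    refine ⟨by linarith, ?_⟩
    have : t + min x (w + z) - y < min z (min (x + w) (v + y)) := by
      rw [← min_assoc]
      exact lt_min (by linarith) (by linarith)
    linarith

lemma expMeasure_prod_Ioi (s u : ℝ) :
    ((expMeasure 1).prod (expMeasure 1)) (Ioi s ×ˢ Ioi u) =
      ENNReal.ofReal (exp (-max s 0) * exp (-max u 0)) := by
  rw [Measure.prod_prod, expMeasure_Ioi, expMeasure_Ioi, ENNReal.ofReal_mul (exp_pos _).le]

/-- Conditionally on the weights `x` and `w`, the event that the gap exceeds `t` is a quadrant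
in the other two weights, by `lt_stepGap_iff`. -/
lemma measureReal_lt_stepGap {z t : ℝ} (hz : 0 ≤ z) (ht : 0 ≤ t) :
    layerLaw.real {e | t < stepGap z e} = ∫ x, ∫ w,
      exp (-(t + min x (w + z))) * exp (-max (t + min x (w + z) - min z (x + w)) 0)
        ∂(expMeasure 1) ∂(expMeasure 1) := by
  set ν := expMeasure 1
  set G : ℝ × ℝ → ℝ := fun p =>
    exp (-max (t + min p.1 (p.2 + z)) 0) *
      exp (-max (t + min p.1 (p.2 + z) - min z (p.1 + p.2)) 0) with hG
  have hGm : Measurable G := by fun_prop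
  have hG0 : ∀ p, 0 ≤ G p := fun p => by positivity
  have hG1 : ∀ p, G p ≤ 1 := fun p => by
    refine mul_le_one₀ ?_ (exp_pos _).le ?_ <;> · rw [exp_le_one_iff]; simp
  have hGi : Integrable G (ν.prod ν) := Integrable.of_bound hGm.aestronglyMeasurable 1
    (ae_of_all _ fun p => by rw [norm_of_nonneg (hG0 p)]; exact hG1 p)
  have hS : MeasurableSet {e : Layer | t + min e.1.1 (e.1.2 + z) < e.2.1 ∧
      t + min e.1.1 (e.1.2 + z) - min z (e.1.1 + e.1.2) < e.2.2} := by
    refine MeasurableSet.inter (s₁ := {e : Layer | t + min e.1.1 (e.1.2 + z) < e.2.1})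
      (s₂ := {e : Layer | t + min e.1.1 (e.1.2 + z) - min z (e.1.1 + e.1.2) < e.2.2}) ?_ ?_ <;>
    exact measurableSet_lt (by fun_prop) (by fun_prop)
  have h1 : layerLaw {e | t < stepGap z e} = ∫⁻ p, ENNReal.ofReal (G p) ∂(ν.prod ν) := by
    have : layerLaw {e | t < stepGap z e} =
        layerLaw {e : Layer | t + min e.1.1 (e.1.2 + z) < e.2.1 ∧
          t + min e.1.1 (e.1.2 + z) - min z (e.1.1 + e.1.2) < e.2.2} := by
      apply measure_congr
      filter_upwards [ae_nonneg_layerLaw] with e he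
      exact propext (lt_stepGap_iff he.1.1 he.1.2 he.2.1 he.2.2 hz ht)
    rw [this, layerLaw, Measure.prod_apply hS]
    refine lintegral_congr fun p => ?_
    exact expMeasure_prod_Ioi (t + min p.1 (p.2 + z))
      (t + min p.1 (p.2 + z) - min z (p.1 + p.2))
  rw [Measure.real, h1, ← ofReal_integral_eq_lintegral_ofReal hGi (ae_of_all _ hG0),
    ENNReal.toReal_ofReal (integral_nonneg hG0), integral_prod _ hGi]
  refine integral_congr_ae ?_
  filter_upwards [ae_nonneg_expMeasure] with x hx
  refine integral_congr_ae ?_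
  filter_upwards [ae_nonneg_expMeasure] with w hw
  simp only [hG]
  rw [max_eq_left (a := t + min x (w + z)) (by positivity)]

/-- For `x ≤ z` the integral over `w` is `exp (-2 t - x) * (1 + min (z - x) t)`, for `x > z` it is
`exp (-2 t - z) * (1 / 3 + 2 / 3 * exp (-3 (x - z)))`; the integral over `x` is then elementary on
`(0, z - s]`, `(z - s, z]` and `(z, ∞)`, where `s = min z t`. -/
lemma measureReal_lt_stepGap_eq {z t : ℝ} (hz : 0 ≤ z) (ht : 0 ≤ t) :
    layerLaw.real {e | t < stepGap z e} = exp (-(2 * t)) / 2 *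
      (1 + min z t - (exp (-(2 * (z - min z t))) - exp (-(2 * z))) / 2) := by
  rw [measureReal_lt_stepGap hz ht]
  -- the integral over `w`, for fixed `x` below and above `z`
  have i1 : ∀ x, 0 ≤ x → x ≤ z → ∫ w, exp (-(t + min x (w + z))) *
      exp (-max (t + min x (w + z) - min z (x + w)) 0) ∂(expMeasure 1) =
        exp (-(2 * t)) * (exp (-x) * (1 + min (z - x) t)) := by
    intro x hx hxz
    have : ∀ᵐ w ∂(expMeasure 1), exp (-(t + min x (w + z))) *
        exp (-max (t + min x (w + z) - min z (x + w)) 0) =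
          exp (-(2 * t) - x) * exp (min (min (z - x) t) w) := by
      filter_upwards [ae_nonneg_expMeasure] with w hw
      rw [← exp_add, ← exp_add, min_eq_left (by linarith : x ≤ w + z)]
      congr 1
      grind
    rw [integral_congr_ae this, integral_const_mul,
      integral_exp_min_expMeasure (le_min (by linarith) ht), sub_eq_add_neg, exp_add, mul_assoc]
  have i2 : ∀ x, z < x → ∫ w, exp (-(t + min x (w + z))) *
      exp (-max (t + min x (w + z) - min z (x + w)) 0) ∂(expMeasure 1) =
        exp (-(2 * t) - z) * (1 / 3 + 2 / 3 * exp (-(3 * (x - z)))) := by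
    intro x hxz
    have : ∀ᵐ w ∂(expMeasure 1), exp (-(t + min x (w + z))) *
        exp (-max (t + min x (w + z) - min z (x + w)) 0) =
          exp (-(2 * t) - z) * exp (-(2 * min (x - z) w)) := by
      filter_upwards [ae_nonneg_expMeasure] with w hw
      rw [← exp_add, ← exp_add]
      congr 1
      grind
    rw [integral_congr_ae this, integral_const_mul,
      integral_exp_neg_two_mul_min_expMeasure (by linarith)]
  rw [integral_expMeasure]
  set J : ℝ → ℝ := fun x => ∫ w, exp (-(t + min x (w + z))) *
      exp (-max (t + min x (w + z) - min z (x + w)) 0) ∂(expMeasure 1)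
  set s := min z t with hs
  have hsz : s ≤ z := min_le_left _ _
  have hs0 : 0 ≤ s := le_min hz ht
  -- on the interval up to `z - s` the minimum of `z - x` and `t` is constant
  obtain ⟨j1, k1⟩ := setIntegral_Ioc_of_hasDerivAt (a := 0) (c := z - s) (by linarith)
    (f := fun x => exp (-x) * J x)
    (F := fun x => -(exp (-(2 * t)) * (1 + s) / 2) * exp (-(2 * x)))
    (F' := fun x => exp (-(2 * t)) * (1 + s) * exp (-(2 * x)))
    (fun x => ((hasDerivAt_exp_neg_mul 2 x).const_mul _).congr_deriv (by ring))
    (by fun_prop)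
    (fun x hx => by
      have : min (z - x) t = s := by have := hx.2; grind
      simp only [J]
      rw [i1 x hx.1.le (by linarith [hx.2]), this,
        show exp (-(2 * x)) = exp (-x) * exp (-x) by rw [← exp_add]; congr 1; ring]
      ring)
  obtain ⟨j2, k2⟩ := setIntegral_Ioc_of_hasDerivAt (a := z - s) (c := z) (by linarith)
    (f := fun x => exp (-x) * J x)
    (F := fun x => exp (-(2 * t)) * (1 / 4 - (1 + z - x) / 2) * exp (-(2 * x)))
    (F' := fun x => exp (-(2 * t)) * (1 + z - x) * exp (-(2 * x)))
    (fun x => by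
      have h := ((((hasDerivAt_id x).const_sub (1 + z)).div_const 2).const_sub (1 / 4)).const_mul
        (exp (-(2 * t)))
      exact (h.mul (hasDerivAt_exp_neg_mul 2 x)).congr_deriv (by simp only [id]; ring))
    (by fun_prop)
    (fun x hx => by
      have : min (z - x) t = z - x := by have := hx.1; grind
      simp only [J]
      rw [i1 x (by linarith [hx.1]) hx.2, this,
        show exp (-(2 * x)) = exp (-x) * exp (-x) by rw [← exp_add]; congr 1; ring]
      ring)
  have hJ : ∀ x ∈ Ioi z, exp (-x) * J x = exp (-(2 * t) - z) / 3 * exp (-(1 * x)) +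
      2 / 3 * exp (-(2 * t) + 2 * z) * exp (-(4 * x)) := by
    intro x hx
    simp only [J]
    rw [i2 x hx]
    have : exp (-(2 * t) + 2 * z) * exp (-(4 * x)) =
        exp (-x) * (exp (-(2 * t) - z) * exp (-(3 * (x - z)))) := by
      simp only [← exp_add]; congr 1; ring
    rw [mul_assoc (2 / 3), this, one_mul]
    ring
  have j3 := (integrableOn_exp_mul_Ioi' one_pos (exp (-(2 * t) - z) / 3) z).add
    (integrableOn_exp_mul_Ioi' (b := 4) (by norm_num) (2 / 3 * exp (-(2 * t) + 2 * z)) z)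
  have k3 : ∫ x in Ioi z, exp (-x) * J x = exp (-(2 * t)) * exp (-(2 * z)) / 2 := by
    rw [setIntegral_congr_fun measurableSet_Ioi hJ, integral_add
      (integrableOn_exp_mul_Ioi' one_pos _ z) (integrableOn_exp_mul_Ioi' (by norm_num) _ z),
      integral_exp_mul_Ioi' one_pos, integral_exp_mul_Ioi' (by norm_num)]
    have h1 : exp (-(2 * t) - z) * exp (-(1 * z)) = exp (-(2 * t)) * exp (-(2 * z)) := by
      simp only [← exp_add]; congr 1; ring
    have h2 : exp (-(2 * t) + 2 * z) * exp (-(4 * z)) = exp (-(2 * t)) * exp (-(2 * z)) := by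
      simp only [← exp_add]; congr 1; ring
    linear_combination h1 / 3 + h2 / 6
  have hu1 : Ioc (z - s) z ∪ Ioi z = Ioi (z - s) := Ioc_union_Ioi_eq_Ioi (by linarith)
  have hu2 : Ioc 0 (z - s) ∪ Ioi (z - s) = Ioi 0 := Ioc_union_Ioi_eq_Ioi (by linarith)
  have j3' : IntegrableOn (fun x => exp (-x) * J x) (Ioi z) :=
    IntegrableOn.congr_fun j3 (fun x hx => (hJ x hx).symm) measurableSet_Ioi
  have j23 : IntegrableOn (fun x => exp (-x) * J x) (Ioi (z - s)) := by
    rw [← hu1]; exact j2.union j3'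
  rw [← hu2, setIntegral_union (Ioc_disjoint_Ioi le_rfl) measurableSet_Ioi j1 j23, k1, ← hu1,
    setIntegral_union (Ioc_disjoint_Ioi le_rfl) measurableSet_Ioi j2 j3', k2, k3]
  rw [mul_zero, neg_zero, exp_zero]
  ring

end FPP

namespace FPP

open Set Real

/-- Exchanging the two levels of the new column turns the gap into its negative. -/
lemma stepGap_swap (z : ℝ) (e : Layer) : stepGap z e.swap = -stepGap z e := by
  simp [stepGap, layerStep, detour, min_comm]

lemma measurePreserving_swap_layerLaw : MeasurePreserving Prod.swap layerLaw layerLaw :=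
  Measure.measurePreserving_swap

lemma measureReal_lt_abs_stepGap {z t : ℝ} (hz : 0 ≤ z) (ht : 0 ≤ t) :
    layerLaw.real {e | t < |stepGap z e|} = exp (-(2 * t)) *
      (1 + min z t - (exp (-(2 * (z - min z t))) - exp (-(2 * z))) / 2) := by
  have hm := measurable_stepGap z
  have hsplit : {e | t < |stepGap z e|} = {e | t < stepGap z e} ∪ {e | t < -stepGap z e} := by
    ext e; simp only [mem_ofPred_eq, mem_union, lt_abs]
  have hdisj : Disjoint {e | t < stepGap z e} {e | t < -stepGap z e} := by
    rw [Set.disjoint_left]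
    intro e h1 h2
    simp only [mem_ofPred_eq] at h1 h2
    linarith
  have hneg : layerLaw.real {e | t < -stepGap z e} = layerLaw.real {e | t < stepGap z e} := by
    have h := measurePreserving_swap_layerLaw.measureReal_preimage
      (s := {e | t < stepGap z e}) (measurableSet_lt measurable_const hm).nullMeasurableSet
    rw [← h]
    congr 1
    ext e
    simp [stepGap_swap]
  rw [hsplit, measureReal_union hdisj (measurableSet_lt measurable_const hm.neg), hneg,
    measureReal_lt_stepGap_eq hz ht]
  ring

/-- The Laplace transform of the modulus of the gap after one step. -/
lemma integral_exp_neg_abs_stepGap {z a : ℝ} (hz : 0 ≤ z) (ha : 0 ≤ a) :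
    ∫ e, exp (-(a * |stepGap z e|)) ∂layerLaw =
      1 - a * (1 + exp (-(2 * z)) / 2) / (a + 2) - a / (a + 2) ^ 2 + exp (-(2 * z)) / 2
        - 2 * exp (-((a + 2) * z)) / (a + 2) ^ 2 := by
  have hm := measurable_stepGap z
  set Q := exp (-(2 * z)) with hQ
  set g : ℝ → ℝ := fun t => a * exp (-(a * t)) with hg
  have hgc : Continuous g := by fun_prop
  have hg0 : ∀ t, 0 ≤ g t := fun t => by positivity
  have hgint : ∀ b, ∫ t in 0..b, g t = 1 - exp (-(a * b)) := by
    intro b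
    rw [intervalIntegral.integral_eq_sub_of_hasDerivAt (f := fun t => -exp (-(a * t)))
      (fun x _ => (hasDerivAt_exp_neg_mul a x).neg.congr_deriv (by simp [hg]))
      (hgc.intervalIntegrable _ _)]
    simp; ring
  set f : ℝ → ℝ := fun t => layerLaw.real {e | t < |stepGap z e|} * g t with hf
  obtain ⟨hfi, hfe⟩ := integral_Ioi_of_split (a := 0) (c := z) (b := a + 2)
    (C := a * (1 / 2 + z + Q / 2)) hz (by linarith) (f := f)
    (F := fun t => a * ((-(1 + Q / 2) / (a + 2) - t / (a + 2) - 1 / (a + 2) ^ 2)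
      * exp (-((a + 2) * t))) + Q / 2 * exp (-(a * t)))
    (F' := fun t => a * ((1 + Q / 2 + t) * exp (-((a + 2) * t))) - a * (Q / 2 * exp (-(a * t))))
    (fun t => by
      have h := ((((hasDerivAt_id t).div_const (a + 2)).const_sub
        (-(1 + Q / 2) / (a + 2))).sub_const (1 / (a + 2) ^ 2)).mul
          (hasDerivAt_exp_neg_mul (a + 2) t)
      refine ((h.const_mul a).add ((hasDerivAt_exp_neg_mul a t).const_mul (Q / 2))).congr_deriv ?_
      have : a + 2 ≠ 0 := by linarith
      simp only [id]
      field_simp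
      ring)
    (by fun_prop)
    (fun t ht => by
      simp only [hf, hg]
      rw [measureReal_lt_abs_stepGap hz ht.1.le, min_eq_right ht.2]
      have h1 : exp (-((a + 2) * t)) = exp (-(2 * t)) * exp (-(a * t)) := by
        rw [← exp_add]; congr 1; ring
      have h2 : exp (-(2 * t)) * exp (-(2 * (z - t))) = Q := by
        rw [hQ, ← exp_add]; congr 1; ring
      rw [h1, ← hQ]
      linear_combination (-(a * exp (-(a * t)) / 2)) * h2)
    (fun t ht => by
      have ht' : z < t := ht
      simp only [hf, hg]
      rw [measureReal_lt_abs_stepGap hz (by linarith), min_eq_left ht'.le]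
      have h1 : exp (-((a + 2) * t)) = exp (-(2 * t)) * exp (-(a * t)) := by
        rw [← exp_add]; congr 1; ring
      rw [h1, ← hQ]
      simp
      ring)
  have hcake := lintegral_comp_eq_lintegral_meas_lt_mul layerLaw (f := fun e => |stepGap z e|)
    (g := g) (ae_of_all _ fun e => abs_nonneg _) (by fun_prop)
    (fun t _ => hgc.intervalIntegrable _ _) (ae_of_all _ hg0)
  have hr : ∫⁻ t in Ioi 0, layerLaw {e | t < |stepGap z e|} * ENNReal.ofReal (g t) =
      ENNReal.ofReal (∫ t in Ioi 0, f t) := by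
    rw [ofReal_integral_eq_lintegral_ofReal hfi
      (ae_of_all _ fun t => mul_nonneg measureReal_nonneg (hg0 t))]
    refine lintegral_congr fun t => ?_
    simp only [hf]
    rw [ENNReal.ofReal_mul measureReal_nonneg, ofReal_measureReal]
  have hE : ∀ e, 0 < exp (-(a * |stepGap z e|)) ∧ exp (-(a * |stepGap z e|)) ≤ 1 := fun e =>
    ⟨exp_pos _, by rw [exp_le_one_iff]; have := mul_nonneg ha (abs_nonneg (stepGap z e)); linarith⟩
  have hi : Integrable (fun e => exp (-(a * |stepGap z e|))) layerLaw :=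
    Integrable.of_bound (by fun_prop) 1
      (ae_of_all _ fun e => by rw [norm_of_nonneg (hE e).1.le]; exact (hE e).2)
  have hl : ∫⁻ e, ENNReal.ofReal (∫ t in 0..|stepGap z e|, g t) ∂layerLaw =
      ENNReal.ofReal (1 - ∫ e, exp (-(a * |stepGap z e|)) ∂layerLaw) := by
    simp only [hgint]
    rw [← ofReal_integral_eq_lintegral_ofReal
      (f := fun e => 1 - exp (-(a * |stepGap z e|))) ((integrable_const 1).sub hi)
      (ae_of_all _ fun e => sub_nonneg.2 (hE e).2), integral_sub (integrable_const 1) hi]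
    simp
  rw [hl, hr] at hcake
  have hle : ∫ e, exp (-(a * |stepGap z e|)) ∂layerLaw ≤ 1 := by
    refine (integral_mono hi (integrable_const 1) fun e => (hE e).2).trans ?_
    simp
  have := (ENNReal.ofReal_eq_ofReal_iff (sub_nonneg.2 hle) (setIntegral_nonneg measurableSet_Ioi
    fun t _ => mul_nonneg measureReal_nonneg (hg0 t))).1 hcake
  rw [hfe] at this
  have h1 : exp (-((a + 2) * z)) = Q * exp (-(a * z)) := by
    rw [hQ, ← exp_add]; congr 1; ring
  simp only [h1, mul_zero, neg_zero, exp_zero] at this ⊢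
  have ha2 : a + 2 ≠ 0 := by linarith
  field_simp at this ⊢
  linear_combination -this

/-- The smaller of the two passage times after a step from the passage times `0` and `z`: the
detours are irrelevant for it. -/
lemma min_layerStep {x w v y z : ℝ} (hx : 0 ≤ x) (hw : 0 ≤ w) (hv : 0 ≤ v) (hy : 0 ≤ y)
    (hz : 0 ≤ z) :
    min (layerStep (0, z) ((x, w), (v, y))).1 (layerStep (0, z) ((x, w), (v, y))).2 =
      min (min x v) (z + min w y) := by
  have h0 : min 0 (z + min (x + w) (v + y)) = 0 := min_eq_left (by positivity)
  simp only [layerStep, detour, h0, zero_add]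
  grind

lemma memLp_id_expMeasure : MemLp (fun x : ℝ => x) 2 (expMeasure 1) :=
  (memLp_two_iff_integrable_sq aestronglyMeasurable_id).2 integrable_sq_expMeasure

lemma integrable_layerLaw : Integrable (fun e : Layer => e.1.1) layerLaw :=
  ((memLp_id_expMeasure.integrable one_le_two).comp_fst _).comp_fst _

lemma integral_min_layerStep {z : ℝ} (hz : 0 ≤ z) :
    ∫ e, min (layerStep (0, z) e).1 (layerStep (0, z) e).2 ∂layerLaw =
      1 / 2 - exp (-(2 * z)) / 4 := by
  have hcongr : (fun e => min (layerStep (0, z) e).1 (layerStep (0, z) e).2) =ᵐ[layerLaw]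
      fun e => min (min e.1.1 e.2.1) (z + min e.1.2 e.2.2) := by
    filter_upwards [ae_nonneg_layerLaw] with e he
    exact min_layerStep he.1.1 he.1.2 he.2.1 he.2.2 hz
  rw [integral_congr_ae hcongr]
  have hnn : ∀ᵐ e ∂layerLaw, 0 ≤ min (min e.1.1 e.2.1) (z + min e.1.2 e.2.2) := by
    filter_upwards [ae_nonneg_layerLaw] with e he
    obtain ⟨⟨h1, h2⟩, h3, h4⟩ := he
    exact le_min (le_min h1 h3) (add_nonneg hz (le_min h2 h4))
  have hint : Integrable (fun e : Layer => min (min e.1.1 e.2.1) (z + min e.1.2 e.2.2))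
      layerLaw := by
    refine integrable_layerLaw.mono'
      (by fun_prop) ?_
    filter_upwards [hnn] with e he
    rw [norm_of_nonneg he]
    exact (min_le_left _ _).trans (min_le_left _ _)
  rw [hint.integral_eq_integral_meas_lt hnn]
  have htail : ∀ t, 0 < t →
      layerLaw.real {e | t < min (min e.1.1 e.2.1) (z + min e.1.2 e.2.2)} =
        exp (-(2 * t)) * exp (-(2 * max (t - z) 0)) := by
    intro t ht
    have : {e : Layer | t < min (min e.1.1 e.2.1) (z + min e.1.2 e.2.2)} =
        (Ioi t ×ˢ Ioi (t - z)) ×ˢ (Ioi t ×ˢ Ioi (t - z)) := by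
      ext ⟨⟨x, w⟩, v, y⟩
      simp only [mem_ofPred_eq, lt_min_iff, mem_prod, mem_Ioi, ← sub_lt_iff_lt_add']
      tauto
    rw [this, layerLaw, measureReal_prod_prod, Measure.real, expMeasure_prod_Ioi,
      ENNReal.toReal_ofReal (by positivity), max_eq_left ht.le]
    simp only [← exp_add]
    congr 1
    ring
  rw [(integral_Ioi_of_split (a := 0) (c := z) (b := 4) (C := exp (2 * z)) hz (by norm_num)
    (F := fun t => -1 / 2 * exp (-(2 * t))) (F' := fun t => exp (-(2 * t)))
    (fun t => ((hasDerivAt_exp_neg_mul 2 t).const_mul _).congr_deriv (by ring))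
    (by fun_prop)
    (fun t ht => by rw [htail t ht.1, max_eq_right (by linarith [ht.2])]; simp)
    (fun t ht => by
      have ht' : z < t := ht
      rw [htail t (by linarith), max_eq_left (by linarith)]
      simp only [← exp_add]
      congr 1
      ring)).2]
  have : exp (2 * z) * exp (-(4 * z)) = exp (-(2 * z)) := by
    rw [← exp_add]; congr 1; ring
  rw [this, mul_zero, neg_zero, exp_zero]
  ring

lemma layerStep_translate (r a b : ℝ) (e : Layer) :
    layerStep (r + a, r + b) e = (r + (layerStep (a, b) e).1, r + (layerStep (a, b) e).2) := by
  simp only [layerStep, add_assoc, min_add_add_left]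

/-- By translation and by exchanging the two levels of the old column, only the distance of the
two passage times matters for a step. -/
lemma integral_layerStep (Φ : ℝ → ℝ → ℝ) (s : ℝ × ℝ) :
    ∫ e, Φ |(layerStep s e).2 - (layerStep s e).1|
      (min (layerStep s e).1 (layerStep s e).2 - min s.1 s.2) ∂layerLaw =
    ∫ e, Φ |stepGap |s.2 - s.1| e|
      (min (layerStep (0, |s.2 - s.1|) e).1 (layerStep (0, |s.2 - s.1|) e).2) ∂layerLaw := by
  have key : ∀ a b : ℝ, a ≤ b → ∀ e,
      Φ |(layerStep (a, b) e).2 - (layerStep (a, b) e).1|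
        (min (layerStep (a, b) e).1 (layerStep (a, b) e).2 - min a b) =
      Φ |stepGap |b - a| e|
        (min (layerStep (0, |b - a|) e).1 (layerStep (0, |b - a|) e).2) := by
    intro a b hab e
    have h := layerStep_translate a 0 (b - a) e
    rw [add_zero, add_sub_cancel] at h
    rw [h, abs_of_nonneg (sub_nonneg.2 hab), min_eq_left hab, stepGap]
    simp only [min_add_add_left, add_sub_cancel_left, add_sub_add_left_eq_sub]
  obtain ⟨a, b⟩ := s
  rcases le_total a b with hab | hab
  · exact integral_congr_ae (ae_of_all _ (key a b hab))
  · let T : Layer ≃ᵐ Layer := MeasurableEquiv.prodComm.prodCongr MeasurableEquiv.prodComm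
    have hT : MeasurePreserving T layerLaw layerLaw :=
      Measure.measurePreserving_swap.prod Measure.measurePreserving_swap
    have hsw : ∀ e, layerStep (a, b) e = layerStep (b, a) (T e) := by
      intro e
      change layerStep (a, b) e = layerStep (b, a) ((e.1.2, e.1.1), (e.2.2, e.2.1))
      simp only [layerStep, detour, add_comm, min_comm]
    simp only [hsw]
    rw [hT.integral_comp' (g := fun e => Φ |(layerStep (b, a) e).2 - (layerStep (b, a) e).1|
      (min (layerStep (b, a) e).1 (layerStep (b, a) e).2 - min a b)), abs_sub_comm b a,
      min_comm a b]
    exact integral_congr_ae (ae_of_all _ (key b a hab))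

end FPP

/-! ### The Bessel function as a corrector -/

namespace FPP

open Set Real

/-- The coefficients of `J₀(√2 √q) = ∑ besselCoeff m * q ^ m`. -/
noncomputable def besselCoeff (m : ℕ) : ℝ := (-1) ^ m / ((m.factorial : ℝ) ^ 2 * 2 ^ m)

lemma besselCoeff_succ (m : ℕ) :
    besselCoeff (m + 1) = -besselCoeff m / (2 * ((m : ℝ) + 1) ^ 2) := by
  unfold besselCoeff
  rw [Nat.factorial_succ]
  push_cast
  have : (m.factorial : ℝ) ≠ 0 := by positivity
  field_simp
  ring

lemma abs_besselCoeff_le (m : ℕ) : |besselCoeff m| ≤ (1 / 2) ^ m := by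
  unfold besselCoeff
  rw [abs_div, abs_pow, abs_neg, abs_one, one_pow, abs_of_pos (by positivity), one_div_pow]
  have h1 : (1 : ℝ) ≤ m.factorial := by exact_mod_cast m.factorial_pos
  gcongr
  have : (1 : ℝ) ≤ (m.factorial : ℝ) ^ 2 := one_le_pow₀ h1
  nlinarith [pow_pos (two_pos : (0 : ℝ) < 2) m]

lemma summable_abs_besselCoeff : Summable fun m => |besselCoeff m| :=
  Summable.of_nonneg_of_le (fun _ => abs_nonneg _) abs_besselCoeff_le
    (summable_geometric_of_lt_one (by norm_num) (by norm_num))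

lemma summable_besselCoeff : Summable besselCoeff := summable_abs_besselCoeff.of_abs

lemma besselJ_zero_sqrt_two : besselJ 0 √2 = ∑' m, besselCoeff m := by
  unfold besselJ besselCoeff
  refine tsum_congr fun m => ?_
  rw [add_zero, add_zero, pow_mul, div_pow, sq_sqrt (by norm_num : (0 : ℝ) ≤ 2)]
  have : (2 / 2 ^ 2 : ℝ) ^ m = 1 / 2 ^ m := by rw [← one_div_pow]; norm_num
  rw [this]
  field_simp

/-- The number `J₁(√2) / √2`, as it comes out of the transition kernel. -/
noncomputable def halfSum : ℝ := ∑' m : ℕ, besselCoeff m / (2 * (m + 1))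

lemma summable_halfSum : Summable fun m : ℕ => besselCoeff m / (2 * ((m : ℝ) + 1)) := by
  refine Summable.of_norm_bounded summable_abs_besselCoeff fun m => ?_
  rw [norm_eq_abs, abs_div, abs_of_pos (a := 2 * ((m : ℝ) + 1)) (by positivity)]
  exact div_le_self (abs_nonneg _) (by linarith [(Nat.cast_nonneg m : (0 : ℝ) ≤ m)])

lemma besselJ_one_sqrt_two : besselJ 1 √2 = √2 * halfSum := by
  unfold besselJ halfSum besselCoeff
  rw [← tsum_mul_left]
  refine tsum_congr fun m => ?_
  rw [pow_succ, pow_mul, div_pow, sq_sqrt (by norm_num : (0 : ℝ) ≤ 2), Nat.factorial_succ]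
  have : (2 / 2 ^ 2 : ℝ) ^ m = 1 / 2 ^ m := by rw [← one_div_pow]; norm_num
  rw [this]
  push_cast
  field_simp

/-- The alternating series of `J₁(√2) / √2` is at least its second partial sum `1/2 - 1/8`. -/
lemma halfSum_pos : 0 < halfSum := by
  set b : ℕ → ℝ := fun m => 1 / ((m.factorial : ℝ) ^ 2 * 2 ^ m * (2 * (m + 1))) with hb
  have hterm : ∀ m : ℕ, besselCoeff m / (2 * (m + 1)) = (-1) ^ m * b m := by
    intro m; simp only [besselCoeff, hb]; field_simp
  have hanti : Antitone b := by
    refine antitone_nat_of_succ_le fun m => ?_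
    simp only [hb]
    have h : (m.factorial : ℝ) ≤ (m + 1).factorial := by
      exact_mod_cast Nat.factorial_le (Nat.le_succ m)
    have h2 : (2 : ℝ) ^ m ≤ 2 ^ (m + 1) := pow_le_pow_right₀ (by norm_num) (Nat.le_succ m)
    push_cast
    gcongr
    linarith
  have hlim := summable_halfSum.hasSum.tendsto_sum_nat
  simp only [hterm] at hlim
  have := hanti.alternating_series_le_tendsto hlim 1
  have h2 : ∑ i ∈ Finset.range (2 * 1), (-1) ^ i * b i = 3 / 8 := by
    simp [Finset.sum_range_succ, hb]; norm_num
  rw [h2] at this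
  have h3 : halfSum = ∑' m : ℕ, (-1) ^ m * b m := tsum_congr hterm
  rw [h3]
  linarith

/-- The function `z ↦ J₀(√2 exp (-|z|))`, which the transition kernel of the gap maps to
itself up to an affine function of `exp (-2 * z)`. The modulus makes it even and bounded. -/
noncomputable def corrector (z : ℝ) : ℝ := ∑' m : ℕ, besselCoeff m * exp (-(2 * m * |z|))

lemma norm_corrector_term_le (m : ℕ) (z : ℝ) :
    ‖besselCoeff m * exp (-(2 * m * |z|))‖ ≤ |besselCoeff m| := by
  rw [norm_mul, norm_eq_abs, norm_of_nonneg (exp_pos _).le]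
  refine mul_le_of_le_one_right (abs_nonneg _) ?_
  rw [exp_le_one_iff]
  have : 0 ≤ 2 * (m : ℝ) * |z| := by positivity
  linarith

lemma continuous_corrector : Continuous corrector :=
  continuous_tsum (fun m => by fun_prop) summable_abs_besselCoeff norm_corrector_term_le

lemma abs_corrector_le (z : ℝ) : |corrector z| ≤ ∑' m, |besselCoeff m| :=
  tsum_of_norm_bounded summable_abs_besselCoeff.hasSum fun m => norm_corrector_term_le m z

/-- The transition kernel maps `besselCoeff m * q ^ m` to a combination of `1`, `q` and the next
term `besselCoeff (m + 1) * q ^ (m + 1)`, where `q = exp (-2 * z)`; summing over `m` reproduces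
the corrector up to an affine function of `q`. -/
lemma integral_corrector_stepGap {z : ℝ} (hz : 0 ≤ z) :
    ∫ e, corrector (stepGap z e) ∂layerLaw =
      corrector z + halfSum * (1 + exp (-(2 * z))) - besselJ 0 √2 := by
  have hm := measurable_stepGap z
  have hi : ∀ m : ℕ, Integrable (fun e => besselCoeff m * exp (-(2 * m * |stepGap z e|)))
      layerLaw := fun m => Integrable.of_bound (by fun_prop) _
    (ae_of_all _ fun e => norm_corrector_term_le m _)
  have hn : ∀ m : ℕ, ∫ e, ‖besselCoeff m * exp (-(2 * m * |stepGap z e|))‖ ∂layerLaw ≤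
      |besselCoeff m| := by
    intro m
    refine (integral_mono (hi m).norm (integrable_const |besselCoeff m|)
      fun e => norm_corrector_term_le m _).trans ?_
    simp
  have h1 := hasSum_integral_of_summable_integral_norm hi
    (Summable.of_nonneg_of_le (fun m => integral_nonneg fun e => norm_nonneg _) hn
      summable_abs_besselCoeff)
  have hterm : ∀ m : ℕ, ∫ e, besselCoeff m * exp (-(2 * m * |stepGap z e|)) ∂layerLaw =
      besselCoeff m / (2 * (m + 1)) * (1 + exp (-(2 * z))) - besselCoeff (m + 1) +
        besselCoeff (m + 1) * exp (-(2 * (m + 1 : ℕ) * |z|)) := by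
    intro m
    rw [integral_const_mul, integral_exp_neg_abs_stepGap hz (by positivity), besselCoeff_succ,
      abs_of_nonneg hz]
    have : (2 * (m : ℝ) + 2) = 2 * (m + 1) := by ring
    push_cast
    rw [this]
    field_simp
    ring
  simp only [hterm] at h1
  have hs : Summable fun m : ℕ => besselCoeff m * exp (-(2 * m * |z|)) :=
    Summable.of_norm_bounded summable_abs_besselCoeff fun m => norm_corrector_term_le m z
  have e1 := hs.sum_add_tsum_nat_add 1
  have e2 := summable_besselCoeff.sum_add_tsum_nat_add 1
  have h2 := ((summable_halfSum.hasSum.mul_right (1 + exp (-(2 * z)))).sub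
    ((summable_nat_add_iff 1).2 summable_besselCoeff).hasSum).add
    ((summable_nat_add_iff 1).2 hs).hasSum
  have h3 := h1.unique h2
  simp only [Finset.sum_range_one, Nat.cast_zero, mul_zero, zero_mul, neg_zero, exp_zero,
    mul_one] at e1 e2
  unfold corrector at *
  rw [h3, besselJ_zero_sqrt_two, halfSum]
  linarith

/-- The time constant, in terms of the two series. -/
noncomputable def timeConstant : ℝ := 3 / 4 - besselJ 0 √2 / (4 * halfSum)

lemma timeConstant_eq :
    timeConstant = 3 / 4 - besselJ 0 √2 / (2 * √2 * besselJ 1 √2) := by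
  have : 2 * √2 * (√2 * halfSum) = 4 * halfSum := by
    linear_combination 2 * halfSum * (mul_self_sqrt (by norm_num : (0 : ℝ) ≤ 2))
  rw [timeConstant, besselJ_one_sqrt_two, this]

/-- The multiple of the corrector that solves the Poisson equation. -/
noncomputable def poissonSol (z : ℝ) : ℝ := corrector z / (4 * halfSum)

lemma continuous_poissonSol : Continuous poissonSol := continuous_corrector.div_const _

lemma exists_abs_poissonSol_le : ∃ B, 0 ≤ B ∧ ∀ z, |poissonSol z| ≤ B := by
  refine ⟨(∑' m, |besselCoeff m|) / (4 * halfSum), ?_, fun z => ?_⟩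
  · have := halfSum_pos
    exact div_nonneg (tsum_nonneg fun m => abs_nonneg _) (by linarith)
  · rw [poissonSol, abs_div, abs_of_pos (a := 4 * halfSum) (by linarith [halfSum_pos])]
    have := halfSum_pos
    gcongr
    exact abs_corrector_le z

lemma poissonSol_abs (z : ℝ) : poissonSol |z| = poissonSol z := by
  simp [poissonSol, corrector]

/-- The difference of the passage times to the two vertices of a column. -/
def gap (s : ℝ × ℝ) : ℝ := s.2 - s.1

/-- The increment over one step of the smaller passage time plus the solution of the Poisson
equation, less the linear drift. -/
noncomputable def increment (s : ℝ × ℝ) (e : Layer) : ℝ :=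
  min (layerStep s e).1 (layerStep s e).2 - min s.1 s.2 - timeConstant
    + poissonSol (gap (layerStep s e)) - poissonSol (gap s)

/-- The Poisson equation: given the past, an increment has mean zero. -/
lemma integral_increment (s : ℝ × ℝ) : ∫ e, increment s e ∂layerLaw = 0 := by
  have h := integral_layerStep
    (fun a b => b - timeConstant + poissonSol a - poissonSol (gap s)) s
  simp only [poissonSol_abs] at h
  have hz : 0 ≤ |s.2 - s.1| := abs_nonneg _
  set z := |s.2 - s.1| with hzdef
  have hgap : poissonSol (gap s) = poissonSol z := (poissonSol_abs _).symm
  obtain ⟨B, -, hB⟩ := exists_abs_poissonSol_le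
  have hi2 : Integrable (fun e => poissonSol (stepGap z e)) layerLaw :=
    Integrable.of_bound (continuous_poissonSol.measurable.comp
      (measurable_stepGap z)).aestronglyMeasurable B (ae_of_all _ fun e => hB _)
  -- a non-integrable function would have integral `0`, but the mean growth is positive
  have hi1 : Integrable (fun e => min (layerStep (0, z) e).1 (layerStep (0, z) e).2)
      layerLaw := by
    by_contra hcon
    have := integral_undef hcon
    rw [integral_min_layerStep hz] at this
    have : exp (-(2 * z)) ≤ 1 := by rw [exp_le_one_iff]; linarith
    linarith
  have h2 : ∫ e, poissonSol (stepGap z e) ∂layerLaw =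
      (corrector z + halfSum * (1 + exp (-(2 * z))) - besselJ 0 √2) / (4 * halfSum) := by
    rw [← integral_corrector_stepGap hz, ← integral_div]; rfl
  have h3 : ∫ e, increment s e ∂layerLaw = ∫ e, (min (layerStep (0, z) e).1 (layerStep (0, z) e).2
      - timeConstant + poissonSol (stepGap z e) - poissonSol z) ∂layerLaw := by
    rw [← hgap]; exact h
  have hi3 : Integrable (fun e => min (layerStep (0, z) e).1 (layerStep (0, z) e).2 -
      timeConstant) layerLaw := hi1.sub (integrable_const _)
  have hi4 : Integrable (fun e => min (layerStep (0, z) e).1 (layerStep (0, z) e).2 -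
      timeConstant + poissonSol (stepGap z e)) layerLaw := hi3.add hi2
  rw [h3, integral_sub hi4 (integrable_const _), integral_add hi3 hi2,
    integral_sub hi1 (integrable_const _), integral_min_layerStep hz, h2]
  simp only [integral_const, probReal_univ, one_smul, timeConstant, poissonSol]
  have := halfSum_pos.ne'
  field_simp
  ring

end FPP

/-! ### Pathwise bounds for one step -/

namespace FPP

open Set Real

/-- All weights of a layer are nonnegative. -/
def Layer.Nonneg (e : Layer) : Prop := (0 ≤ e.1.1 ∧ 0 ≤ e.1.2) ∧ (0 ≤ e.2.1 ∧ 0 ≤ e.2.2)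

lemma Layer.Nonneg.detour_nonneg {e : Layer} (he : e.Nonneg) : 0 ≤ detour e :=
  le_min (add_nonneg he.1.1 he.1.2) (add_nonneg he.2.1 he.2.2)

lemma min_le_min_layerStep {e : Layer} (he : e.Nonneg) (s : ℝ × ℝ) :
    min s.1 s.2 ≤ min (layerStep s e).1 (layerStep s e).2 := by
  obtain ⟨a, b⟩ := s
  have hd := he.detour_nonneg
  obtain ⟨⟨h1, h2⟩, h3, h4⟩ := he
  have ha : min a b ≤ min a (b + detour e) := le_min (min_le_left _ _) (by grind)
  have hb : min a b ≤ min b (a + detour e) := le_min (min_le_right _ _) (by grind)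
  exact le_min (le_min (by simp only; linarith) (by simp only; linarith))
    (le_min (by simp only; linarith) (by simp only; linarith))

lemma min_layerStep_le {e : Layer} (he : e.Nonneg) (s : ℝ × ℝ) :
    min (layerStep s e).1 (layerStep s e).2 ≤ min s.1 s.2 + (e.1.1 + e.1.2) := by
  obtain ⟨a, b⟩ := s
  obtain ⟨⟨h1, h2⟩, h3, h4⟩ := he
  refine (min_le_left _ _).trans ?_
  rw [← min_add_add_right]
  refine le_min ((min_le_left _ _).trans ?_) ((min_le_right _ _).trans ?_)
  · have : min a (b + detour e) ≤ a := min_le_left _ _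
    simp only; linarith
  · have : min b (a + detour e) ≤ b := min_le_left _ _
    simp only; linarith

lemma layerStep_fst_le {e : Layer} (he : e.Nonneg) (s : ℝ × ℝ) :
    (layerStep s e).1 ≤ min (layerStep s e).1 (layerStep s e).2 + (e.1.1 + e.2.1) := by
  obtain ⟨a, b⟩ := s
  have hd := he.detour_nonneg
  have hd' : detour e ≤ e.2.1 + e.2.2 := min_le_right _ _
  obtain ⟨⟨h1, h2⟩, h3, h4⟩ := he
  have h5 : min a (b + detour e) ≤ min b (a + detour e) + detour e := by grind
  have h6 : (layerStep (a, b) e).1 ≤ min a (b + detour e) + e.1.1 := min_le_left _ _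
  rw [← min_add_add_right]
  refine le_min (by linarith) ?_
  have h7 : (layerStep (a, b) e).2 = min (min a (b + detour e) + e.2.1)
    (min b (a + detour e) + e.2.2) := rfl
  rw [h7, ← min_add_add_right]
  exact le_min (by linarith) (by linarith)

lemma measurable_increment : Measurable fun q : (ℝ × ℝ) × Layer => increment q.1 q.2 := by
  have h1 := measurable_layerStep
  have h2 := continuous_poissonSol.measurable
  unfold increment gap
  fun_prop

lemma exists_abs_increment_le : ∃ K, 0 ≤ K ∧ ∀ s e, Layer.Nonneg e →
    |increment s e| ≤ e.1.1 + e.1.2 + K := by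
  obtain ⟨B, hB0, hB⟩ := exists_abs_poissonSol_le
  refine ⟨|timeConstant| + 2 * B, by positivity, fun s e he => ?_⟩
  have h1 := min_le_min_layerStep he s
  have h2 := min_layerStep_le he s
  have h3 := abs_le.1 (hB (gap (layerStep s e)))
  have h4 := abs_le.1 (hB (gap s))
  have h5 := neg_abs_le timeConstant
  have h6 := le_abs_self timeConstant
  obtain ⟨⟨h7, h8⟩, -⟩ := he
  rw [increment, abs_le]
  constructor <;> linarith

/-! ### Convergence along the recursion -/

/-- Square-integrable variables with summable second moments tend to zero almost surely. -/
lemma ae_tendsto_zero_of_summable_integral_sq {Ω : Type*} [MeasurableSpace Ω] {μ : Measure Ω}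
    {f : ℕ → Ω → ℝ} (hf : ∀ n, MemLp (f n) 2 μ) (hs : Summable fun n => ∫ ω, f n ω ^ 2 ∂μ) :
    ∀ᵐ ω ∂μ, Tendsto (fun n => f n ω) atTop (𝓝 0) := by
  have hm : ∀ n, AEMeasurable (fun ω => ENNReal.ofReal (f n ω ^ 2)) μ := fun n =>
    ((hf n).aestronglyMeasurable.aemeasurable.pow_const 2).ennreal_ofReal
  have h1 : ∫⁻ ω, ∑' n, ENNReal.ofReal (f n ω ^ 2) ∂μ ≠ ⊤ := by
    rw [lintegral_tsum hm]
    have : ∀ n, ∫⁻ ω, ENNReal.ofReal (f n ω ^ 2) ∂μ = ENNReal.ofReal (∫ ω, f n ω ^ 2 ∂μ) :=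
      fun n => (ofReal_integral_eq_lintegral_ofReal (hf n).integrable_sq
        (ae_of_all _ fun ω => sq_nonneg _)).symm
    simp only [this]
    exact hs.tsum_ofReal_ne_top
  filter_upwards [ae_lt_top' (AEMeasurable.tsum hm) h1] with ω hω
  have h2 := ENNReal.tendsto_atTop_zero_of_tsum_ne_top hω.ne
  have h3 := (ENNReal.tendsto_toReal ENNReal.zero_ne_top).comp h2
  simp only [ENNReal.toReal_zero] at h3
  have h4 : Tendsto (fun n => √(f n ω ^ 2)) atTop (𝓝 0) := by
    have := (continuous_sqrt.tendsto 0).comp h3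
    rw [sqrt_zero] at this
    refine this.congr fun n => ?_
    simp [ENNReal.toReal_ofReal (sq_nonneg _)]
  simp only [sqrt_sq_eq_abs] at h4
  exact (tendsto_zero_iff_abs_tendsto_zero _).2 h4

lemma summable_inv_succ_sq (C : ℝ) : Summable fun k : ℕ => C / ((k : ℝ) + 1) ^ 2 := by
  have h := (summable_nat_add_iff 1).2 (Real.summable_one_div_nat_pow.2 (one_lt_two))
  refine (h.mul_left C).congr fun k => ?_
  push_cast
  ring

section Recursion

variable {Ω : Type*} [MeasurableSpace Ω] {μ : Measure Ω} [IsProbabilityMeasure μ]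

/-- The layers of a family of weights indexed by the column and the two levels of an edge. -/
def layers (U : ℕ × Fin 2 × Fin 2 → Ω → ℝ) (ω : Ω) (n : ℕ) : Layer :=
  ((U (n, 0, 0) ω, U (n, 1, 0) ω), (U (n, 0, 1) ω, U (n, 1, 1) ω))

variable {U : ℕ × Fin 2 × Fin 2 → Ω → ℝ} (hUm : ∀ i, Measurable (U i)) (hU : iIndepFun U μ)
  (hlaw : ∀ i, μ.map (U i) = expMeasure 1)
include hUm

lemma measurable_layers (n : ℕ) : Measurable fun ω => layers U ω n := by
  unfold layers; fun_prop

include hU hlaw in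
lemma map_layers (n : ℕ) : μ.map (fun ω => layers U ω n) = layerLaw := by
  have pair : ∀ i j, i ≠ j → μ.map (fun ω => (U i ω, U j ω)) =
      (expMeasure 1).prod (expMeasure 1) := by
    intro i j hij
    rw [(hU.indepFun hij).map_prod_eq_prod_map_map (hUm i).aemeasurable (hUm j).aemeasurable,
      hlaw, hlaw]
  have h := hU.indepFun_prodMk_prodMk hUm (n, 0, 0) (n, 1, 0) (n, 0, 1) (n, 1, 1)
    (by simp) (by simp) (by simp) (by simp)
  have := h.map_prod_eq_prod_map_map (by fun_prop) (by fun_prop)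
  rw [pair _ _ (by simp), pair _ _ (by simp)] at this
  exact this

include hU hlaw in
lemma ae_nonneg_layers : ∀ᵐ ω ∂μ, ∀ n, (layers U ω n).Nonneg := by
  rw [ae_all_iff]
  intro n
  have h := ae_nonneg_layerLaw
  rw [← map_layers hUm hU hlaw n] at h
  exact ae_of_ae_map (measurable_layers hUm n).aemeasurable h

lemma measurable_arrival (n : ℕ) : Measurable fun ω => arrival (layers U ω) n := by
  induction n with
  | zero =>
    have := measurable_layers hUm 0
    simp only [arrival, detour]
    fun_prop
  | succ n ih => exact measurable_layerStep.comp (ih.prodMk (measurable_layers hUm n))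

omit [IsProbabilityMeasure μ] in
include hU in
/-- From column `1` on, the passage times to a column are independent of the next layer. -/
lemma indepFun_arrival_layers (n : ℕ) : IndepFun (fun ω => arrival (layers U ω) (n + 1))
    (fun ω => layers U ω (n + 1)) μ := by
  let m : ℕ × Fin 2 × Fin 2 → MeasurableSpace Ω :=
    fun i => MeasurableSpace.comap (U i) inferInstance
  have hindep : iIndep m μ := hU
  -- the information on the layers with indices in `T`
  let F : Set ℕ → MeasurableSpace Ω := fun T => ⨆ i ∈ {i : ℕ × Fin 2 × Fin 2 | i.1 ∈ T}, m i
  have hUF : ∀ (T : Set ℕ) i, i.1 ∈ T → Measurable[F T] (U i) := by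
    intro T i hi
    have h1 : m i ≤ F T := le_iSup₂_of_le i hi le_rfl
    exact (comap_measurable (U i)).mono h1 le_rfl
  have hlay : ∀ (T : Set ℕ) k, k ∈ T → Measurable[F T] fun ω => layers U ω k := by
    intro T k hk
    exact ((hUF T (k, 0, 0) hk).prodMk (hUF T (k, 1, 0) hk)).prodMk
      ((hUF T (k, 0, 1) hk).prodMk (hUF T (k, 1, 1) hk))
  have harr : ∀ k, Measurable[F (Iio (k + 1))] fun ω => arrival (layers U ω) (k + 1) := by
    intro k
    induction k with
    | zero =>
      have h0 : Measurable fun e : Layer => layerStep (0, detour e) e := by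
        unfold layerStep detour; fun_prop
      exact h0.comp (hlay (Iio 1) 0 (by simp))
    | succ k ih =>
      have hmono : F (Iio (k + 1)) ≤ F (Iio (k + 1 + 1)) :=
        biSup_mono fun i (hi : i.1 < k + 1) => Nat.lt_succ_of_lt hi
      exact measurable_layerStep.comp
        ((ih.mono hmono le_rfl).prodMk (hlay (Iio (k + 1 + 1)) (k + 1) (by simp)))
  have hdisj : Disjoint {i : ℕ × Fin 2 × Fin 2 | i.1 ∈ Iio (n + 1)}
      {i : ℕ × Fin 2 × Fin 2 | i.1 ∈ ({n + 1} : Set ℕ)} := by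
    rw [Set.disjoint_left]
    intro i (h1 : i.1 < n + 1) (h2 : i.1 = n + 1)
    omega
  have hI : Indep (F (Iio (n + 1))) (F {n + 1}) μ :=
    indep_iSup_of_disjoint (fun i => (hUm i).comap_le) hindep hdisj
  rw [IndepFun_iff_Indep]
  exact indep_of_indep_of_le_left
    (indep_of_indep_of_le_right hI (hlay {n + 1} (n + 1) rfl).comap_le) (harr n).comap_le

/-- The compensated passage time to column `n + 1`: a martingale. -/
noncomputable def compensated (U : ℕ × Fin 2 × Fin 2 → Ω → ℝ) (n : ℕ) (ω : Ω) : ℝ :=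
  min (arrival (layers U ω) (n + 1)).1 (arrival (layers U ω) (n + 1)).2
    - timeConstant * ((n : ℝ) + 1) + poissonSol (gap (arrival (layers U ω) (n + 1)))

omit [MeasurableSpace Ω] hUm in
lemma compensated_succ (n : ℕ) (ω : Ω) : compensated U (n + 1) ω = compensated U n ω +
    increment (arrival (layers U ω) (n + 1)) (layers U ω (n + 1)) := by
  have h : arrival (layers U ω) (n + 1 + 1) =
    layerStep (arrival (layers U ω) (n + 1)) (layers U ω (n + 1)) := rfl
  simp only [compensated, increment, h]
  push_cast
  ring

include hlaw

omit [IsProbabilityMeasure μ] in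
lemma memLp_layers (n : ℕ) : MemLp (fun ω => (layers U ω n).1.1) 2 μ ∧
    MemLp (fun ω => (layers U ω n).1.2) 2 μ ∧ MemLp (fun ω => (layers U ω n).2.1) 2 μ := by
  have h2 : ∀ i, MemLp (U i) 2 μ := fun i =>
    memLp_id_expMeasure.comp_measurePreserving (f := U i) ⟨hUm i, hlaw i⟩
  exact ⟨h2 _, h2 _, h2 _⟩

include hU

lemma integral_comp_layers (f : Layer → ℝ) (hf : Measurable f) (n : ℕ) :
    ∫ ω, f (layers U ω n) ∂μ = ∫ e, f e ∂layerLaw := by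
  rw [← map_layers hUm hU hlaw n, integral_map (measurable_layers hUm n).aemeasurable
    hf.aestronglyMeasurable]

lemma memLp_increment (n : ℕ) : MemLp (fun ω =>
    increment (arrival (layers U ω) (n + 1)) (layers U ω (n + 1))) 2 μ := by
  obtain ⟨K, hK0, hK⟩ := exists_abs_increment_le
  obtain ⟨h1, h2, -⟩ := memLp_layers hUm hlaw (n + 1)
  refine ((h1.add h2).add (memLp_const K)).mono'
    (measurable_increment.comp ((measurable_arrival hUm _).prodMk
      (measurable_layers hUm _))).aestronglyMeasurable ?_
  filter_upwards [ae_nonneg_layers hUm hU hlaw] with ω hω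
  exact hK _ _ (hω _)

lemma exists_integral_sq_increment_le : ∃ C, 0 ≤ C ∧ ∀ n, ∫ ω,
    increment (arrival (layers U ω) (n + 1)) (layers U ω (n + 1)) ^ 2 ∂μ ≤ C := by
  obtain ⟨K, hK0, hK⟩ := exists_abs_increment_le
  refine ⟨∫ e, (e.1.1 + e.1.2 + K) ^ 2 ∂layerLaw, integral_nonneg fun e => sq_nonneg _,
    fun n => ?_⟩
  rw [← integral_comp_layers hUm hU hlaw (fun e => (e.1.1 + e.1.2 + K) ^ 2) (by fun_prop) (n + 1)]
  obtain ⟨h1, h2, -⟩ := memLp_layers hUm hlaw (n + 1)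
  refine integral_mono_ae (memLp_increment hUm hU hlaw n).integrable_sq
    ((h1.add h2).add (memLp_const K)).integrable_sq ?_
  filter_upwards [ae_nonneg_layers hUm hU hlaw] with ω hω
  exact sq_le_sq.2 ((hK _ _ (hω _)).trans (le_abs_self _))

lemma memLp_compensated (n : ℕ) : MemLp (compensated U n) 2 μ := by
  induction n with
  | zero =>
    obtain ⟨B, hB0, hB⟩ := exists_abs_poissonSol_le
    obtain ⟨h1, -, h3⟩ := memLp_layers hUm hlaw 0
    have hm := measurable_arrival hUm 1
    have hm0 := measurable_layers hUm 0
    have hp : MemLp (fun ω => poissonSol (gap (arrival (layers U ω) 1))) 2 μ := by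
      refine MemLp.of_bound (C := B) ?_ (ae_of_all _ fun ω => hB _)
      have h2 := continuous_poissonSol.measurable
      unfold gap
      exact Measurable.aestronglyMeasurable (by fun_prop)
    have hmin : MemLp (fun ω => min (arrival (layers U ω) 1).1 (arrival (layers U ω) 1).2) 2 μ := by
      refine h1.mono' (Measurable.aestronglyMeasurable (by fun_prop)) ?_
      filter_upwards [ae_nonneg_layers hUm hU hlaw] with ω hω
      have hd := (hω 0).detour_nonneg
      have g1 := min_le_min_layerStep (hω 0) (0, detour (layers U ω 0))
      have g2 : arrival (layers U ω) 1 = layerStep (0, detour (layers U ω 0)) (layers U ω 0) := rfl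
      rw [g2, norm_of_nonneg ((le_min le_rfl hd).trans g1)]
      refine (min_le_left _ _).trans ((min_le_left _ _).trans ?_)
      have : min 0 (detour (layers U ω 0) + detour (layers U ω 0)) ≤ 0 := min_le_left _ _
      simp only
      linarith
    exact (hmin.sub (memLp_const _)).add hp
  | succ n ih =>
    have := ih.add (memLp_increment hUm hU hlaw n)
    exact this.ae_eq (ae_of_all _ fun ω => (compensated_succ n ω).symm)

/-- The next increment is orthogonal to the past. -/
lemma integral_compensated_mul_increment (n : ℕ) : ∫ ω, compensated U n ω *
    increment (arrival (layers U ω) (n + 1)) (layers U ω (n + 1)) ∂μ = 0 := by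
  set Φ : (ℝ × ℝ) × Layer → ℝ := fun q =>
    (min q.1.1 q.1.2 - timeConstant * ((n : ℝ) + 1) + poissonSol (gap q.1)) * increment q.1 q.2
    with hΦ
  have hΦm : Measurable Φ := by
    have h1 := measurable_increment
    have h2 := continuous_poissonSol.measurable
    simp only [hΦ, gap]
    fun_prop
  have hmeas : AEMeasurable (fun ω => (arrival (layers U ω) (n + 1), layers U ω (n + 1))) μ :=
    ((measurable_arrival hUm _).prodMk (measurable_layers hUm _)).aemeasurable
  have hmap := (indepFun_arrival_layers hUm hU n).map_prod_eq_prod_map_map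
    (measurable_arrival hUm _).aemeasurable (measurable_layers hUm _).aemeasurable
  rw [map_layers hUm hU hlaw] at hmap
  have hint : Integrable (fun ω => Φ (arrival (layers U ω) (n + 1), layers U ω (n + 1))) μ :=
    (memLp_compensated hUm hU hlaw n).integrable_mul (memLp_increment hUm hU hlaw n)
  have hint' := (integrable_map_measure hΦm.aestronglyMeasurable hmeas).2 hint
  have h1 : ∫ ω, Φ (arrival (layers U ω) (n + 1), layers U ω (n + 1)) ∂μ = 0 := by
    rw [← integral_map hmeas hΦm.aestronglyMeasurable]
    rw [hmap] at hint' ⊢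
    rw [integral_prod _ hint']
    simp only [hΦ, integral_const_mul, integral_increment, mul_zero, integral_zero]
  exact h1

lemma exists_integral_sq_compensated_le : ∃ C, 0 ≤ C ∧ ∀ n : ℕ,
    ∫ ω, compensated U n ω ^ 2 ∂μ ≤ C * ((n : ℝ) + 1) := by
  obtain ⟨C, hC0, hC⟩ := exists_integral_sq_increment_le hUm hU hlaw
  set A := ∫ ω, compensated U 0 ω ^ 2 ∂μ
  have hA : 0 ≤ A := integral_nonneg fun ω => sq_nonneg _
  refine ⟨A + C, by positivity, fun n => ?_⟩
  induction n with
  | zero => simp only [Nat.cast_zero, zero_add, mul_one]; linarith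
  | succ n ih =>
    have hM := memLp_compensated hUm hU hlaw n
    have hI := memLp_increment hUm hU hlaw n
    have hexp : ∀ ω, compensated U (n + 1) ω ^ 2 = compensated U n ω ^ 2 +
        2 * (compensated U n ω *
          increment (arrival (layers U ω) (n + 1)) (layers U ω (n + 1))) +
        increment (arrival (layers U ω) (n + 1)) (layers U ω (n + 1)) ^ 2 := by
      intro ω; rw [compensated_succ]; ring
    have i2 : Integrable (fun ω => 2 * (compensated U n ω *
        increment (arrival (layers U ω) (n + 1)) (layers U ω (n + 1)))) μ :=
      (hM.integrable_mul hI).const_mul 2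
    have i12 : Integrable (fun ω => compensated U n ω ^ 2 + 2 * (compensated U n ω *
        increment (arrival (layers U ω) (n + 1)) (layers U ω (n + 1)))) μ :=
      hM.integrable_sq.add i2
    simp only [hexp]
    rw [integral_add i12 hI.integrable_sq, integral_add hM.integrable_sq i2,
      integral_const_mul, integral_compensated_mul_increment hUm hU hlaw]
    push_cast
    have := hC n
    linarith

/-- Along the squares, the compensated passage time is negligible. -/
lemma ae_tendsto_compensated_sq : ∀ᵐ ω ∂μ,
    Tendsto (fun k : ℕ => compensated U (k ^ 2 + 2 * k) ω / ((k : ℝ) + 1) ^ 2) atTop (𝓝 0) := by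
  obtain ⟨C, hC0, hC⟩ := exists_integral_sq_compensated_le hUm hU hlaw
  refine ae_tendsto_zero_of_summable_integral_sq (fun k => ?_) ?_
  · simp only [div_eq_mul_inv]
    exact (memLp_compensated hUm hU hlaw _).mul_const _
  · refine Summable.of_nonneg_of_le (fun k => integral_nonneg fun ω => sq_nonneg _) (fun k => ?_)
      (summable_inv_succ_sq C)
    simp only [div_pow]
    rw [integral_div, div_le_div_iff₀ (by positivity) (by positivity)]
    have h := hC (k ^ 2 + 2 * k)
    have h1 : (((k ^ 2 + 2 * k : ℕ) : ℝ) + 1) = ((k : ℝ) + 1) ^ 2 := by push_cast; ring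
    rw [h1] at h
    nlinarith [sq_nonneg (((k : ℝ) + 1))]

lemma ae_tendsto_layers_div : ∀ᵐ ω ∂μ, Tendsto
    (fun n : ℕ => ((layers U ω n).1.1 + (layers U ω n).2.1) / ((n : ℝ) + 1)) atTop (𝓝 0) := by
  refine ae_tendsto_zero_of_summable_integral_sq (fun k => ?_) ?_
  · obtain ⟨h1, -, h3⟩ := memLp_layers hUm hlaw k
    simp only [div_eq_mul_inv]
    exact (h1.add h3).mul_const _
  · refine (summable_inv_succ_sq (∫ e, (e.1.1 + e.2.1) ^ 2 ∂layerLaw)).congr fun k => ?_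
    simp only [div_pow]
    rw [integral_div,
      integral_comp_layers hUm hU hlaw (fun e => (e.1.1 + e.2.1) ^ 2) (by fun_prop)]

/-- The law of large numbers for the recursion. -/
theorem ae_tendsto_arrival_div : ∀ᵐ ω ∂μ,
    Tendsto (fun n : ℕ => (arrival (layers U ω) n).1 / n) atTop (𝓝 timeConstant) := by
  obtain ⟨B, hB0, hB⟩ := exists_abs_poissonSol_le
  filter_upwards [ae_nonneg_layers hUm hU hlaw, ae_tendsto_compensated_sq hUm hU hlaw,
    ae_tendsto_layers_div hUm hU hlaw] with ω hnn hcomp hlay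
  set u : ℕ → ℝ := fun n => min (arrival (layers U ω) n).1 (arrival (layers U ω) n).2 with hu
  have hmono : Monotone u := monotone_nat_of_le_succ fun n => min_le_min_layerStep (hnn n) _
  have hk : Tendsto (fun k : ℕ => (k : ℝ) + 1) atTop atTop :=
    tendsto_natCast_atTop_atTop.atTop_add tendsto_const_nhds
  have hk2 : Tendsto (fun k : ℕ => ((k : ℝ) + 1) ^ 2) atTop atTop :=
    (tendsto_pow_atTop two_ne_zero).comp hk
  -- column `(k + 1) ^ 2` has index `k ^ 2 + 2 * k` in `compensated`
  have hsub : Tendsto (fun k : ℕ => u ((k + 1) ^ 2) / ((k + 1) ^ 2 : ℕ)) atTop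
      (𝓝 timeConstant) := by
    have hp : Tendsto (fun k : ℕ => poissonSol (gap (arrival (layers U ω) (k ^ 2 + 2 * k + 1))) /
        ((k : ℝ) + 1) ^ 2) atTop (𝓝 0) := by
      have hB' : Tendsto (fun k : ℕ => B / ((k : ℝ) + 1) ^ 2) atTop (𝓝 0) :=
        hk2.const_div_atTop B
      refine squeeze_zero_norm (fun k => ?_) hB'
      rw [norm_div, norm_of_nonneg (by positivity : (0 : ℝ) ≤ ((k : ℝ) + 1) ^ 2)]
      gcongr
      exact hB _
    have := (hcomp.sub hp).add_const timeConstant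
    rw [sub_zero, zero_add] at this
    refine this.congr fun k => ?_
    have e1 : (k + 1) ^ 2 = k ^ 2 + 2 * k + 1 := by ring
    have e2 : ((k : ℝ) + 1) ^ 2 ≠ 0 := by positivity
    rw [e1]
    simp only [compensated, hu]
    have e3 : (((k ^ 2 + 2 * k : ℕ) : ℝ) + 1) = ((k : ℝ) + 1) ^ 2 := by push_cast; ring
    have e4 : ((k ^ 2 + 2 * k + 1 : ℕ) : ℝ) = ((k : ℝ) + 1) ^ 2 := by push_cast; ring
    rw [e3, e4]
    field_simp
    ring
  have hlim : Tendsto (fun n => u n / n) atTop (𝓝 timeConstant) := by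
    refine tendsto_div_of_monotone_of_exists_subseq_tendsto_div u _ hmono fun a ha =>
      ⟨fun k => (k + 1) ^ 2, ?_, ?_, hsub⟩
    · have h1 : Tendsto (fun k : ℕ => (1 + 1 / ((k : ℝ) + 1)) ^ 2) atTop (𝓝 1) := by
        have := ((hk.const_div_atTop 1).const_add 1).pow 2
        simpa using this
      filter_upwards [h1.eventually_le_const ha] with k hka
      have hpos : (0 : ℝ) < (k : ℝ) + 1 := by positivity
      have e : (1 + 1 / ((k : ℝ) + 1)) ^ 2 * ((k : ℝ) + 1) ^ 2 = ((k : ℝ) + 1 + 1) ^ 2 := by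
        field_simp
      push_cast
      rw [← e]
      gcongr
    · exact tendsto_atTop_mono (fun k => by nlinarith : ∀ k : ℕ, k ≤ (k + 1) ^ 2) tendsto_id
  -- the shift by one column makes the last layer available
  rw [← tendsto_add_atTop_iff_nat 1] at hlim ⊢
  have hup := hlim.add hlay
  rw [add_zero] at hup
  refine tendsto_of_tendsto_of_tendsto_of_le_of_le hlim hup (fun n => ?_) (fun n => ?_)
  · exact div_le_div_of_nonneg_right (min_le_left _ _) (Nat.cast_nonneg _)
  · have h := layerStep_fst_le (hnn n) (arrival (layers U ω) n)
    push_cast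
    rw [← add_div]
    gcongr
    exact h

end Recursion

end FPP

open FPP in
theorem mainTheorem2 {Ω : Type*} [MeasurableSpace Ω] (μ : Measure Ω) [IsProbabilityMeasure μ]
    (w : Sym2 FPP.Vertex → Ω → ℝ)
    (hindep : iIndepFun
      (fun (e : (FPP.fullStretch {.V, .W, .X, .Y}).edgeSet) => w (e : Sym2 FPP.Vertex)) μ)
    (hlaw : ∀ e ∈ (FPP.fullStretch {.V, .W, .X, .Y}).edgeSet, HasLaw (w e) (expMeasure 1) μ) :
    ∀ᵐ ω ∂μ, Tendsto
      (fun n : ℕ => FPP.passageTime {.V, .W, .X, .Y} (fun e => w e ω) n / (n : ℝ)) atTop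
      (𝓝 (3 / 4 - besselJ 0 (Real.sqrt 2) / (2 * Real.sqrt 2 * besselJ 1 (Real.sqrt 2)))) := by
  have hmem : ∀ i : ℕ × Fin 2 × Fin 2, (s((i.1, i.2.1), (i.1 + 1, i.2.2)) : Sym2 Vertex) ∈
      (fullStretch {.V, .W, .X, .Y}).edgeSet := by
    intro i
    rw [SimpleGraph.mem_edgeSet, fullStretch, SimpleGraph.iSup_adj]
    exact ⟨i.1 + 1, stretch_adj (Nat.lt_succ_self _) _ _⟩
  set g : ℕ × Fin 2 × Fin 2 → (fullStretch {.V, .W, .X, .Y}).edgeSet :=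
    fun i => ⟨_, hmem i⟩ with hg
  have hinj : Function.Injective g := by
    rintro ⟨n, a, b⟩ ⟨n', a', b'⟩ h
    have h' := congrArg Subtype.val h
    simp only [hg, Sym2.eq_iff, Prod.mk.injEq] at h'
    rcases h' with ⟨⟨rfl, rfl⟩, -, rfl⟩ | ⟨⟨h1, -⟩, h2, -⟩
    · rfl
    · omega
  have hae : ∀ i, AEMeasurable (w (g i)) μ := fun i => (hlaw _ (g i).2).aemeasurable
  -- measurable versions of the weights
  set U : ℕ × Fin 2 × Fin 2 → Ω → ℝ := fun i => (hae i).mk (w (g i)) with hUdef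
  have hUae : ∀ i, w (g i) =ᵐ[μ] U i := fun i => (hae i).ae_eq_mk
  have hUm : ∀ i, Measurable (U i) := fun i => (hae i).measurable_mk
  have hU : iIndepFun U μ := (hindep.precomp hinj).congr hUae
  have hUlaw : ∀ i, μ.map (U i) = expMeasure 1 := fun i => by
    rw [← Measure.map_congr (hUae i)]
    exact (hlaw _ (g i).2).map_eq
  rw [← timeConstant_eq]
  filter_upwards [ae_tendsto_arrival_div hUm hU hUlaw, ae_nonneg_layers hUm hU hUlaw,
    ae_all_iff.2 hUae] with ω hlim hnn heq
  have hlayers : layerWeights (fun e => w e ω) = layers U ω := by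
    funext n
    simp only [layers, ← heq]
    rfl
  have hw : ∀ (i : ℕ) (a b : Fin 2), 0 ≤ w s((i, a), (i + 1, b)) ω := by
    intro i a b
    have h : w s((i, a), (i + 1, b)) ω = U (i, a, b) ω := heq (i, a, b)
    rw [h]
    obtain ⟨⟨h1, h2⟩, h3, h4⟩ := hnn i
    fin_cases a <;> fin_cases b
    exacts [h1, h3, h2, h4]
  refine hlim.congr fun n => ?_
  rw [passageTime_eq_arrival hw, hlayers]
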